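/- Let $n\ge 1$, let $\Omega\subset\mathbb R^n$ be a bounded open set (for instance a bounded Lipschitz domain), let $s>0$ and $T>0$. All functions are real-valued. Let $\widetilde H^s(\Omega)$ be the closure of $C_c^\infty(\Omega)$ in $H^s(\mathbb R^n)$, with the norm $\|u\|_{\widetilde H^s(\Omega)}=\|(-\Delta)^{s/2}u\|_{L^2(\mathbb R^n)}$, let $\widetilde L^2(\Omega)$ be the closure of $C_c^\infty(\Omega)$ in $L^2(\mathbb R^n)$, and let $H^{-s}(\Omega)=(\widetilde H^s(\Omega))^*$ with the dual norm; $\langle\cdot,\cdot\rangle$ denotes the duality pairing, and $\widetilde L^2(\Omega)\subset H^{-s}(\Omega)$ via the $L^2$ inner product. For $G\in L^2(0,T;\widetilde L^2(\Omega))$, a weak solution of the backward problem $$\partial_t^2 v+(-\Delta)^s v=G\ \text{ in }\Omega\times(0,T),\qquad v=0\ \text{ in }(\mathbb R^n\setminus\overline\Omega)\times(0,T),\qquad v(T)=\partial_t v(T)=0\ \text{ in }\Omega$$ is a function $v\in C([0,T];\widetilde H^s(\Omega))\cap C^1([0,T];\widetilde L^2(\Omega))$ with $v(T)=\partial_tv(T)=0$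 and $$\frac{d}{dt}\langle\partial_t v,w\rangle_{L^2}+\langle(-\Delta)^{s/2}v,(-\Delta)^{s/2}w\rangle_{L^2(\mathbb R^n)}=\langle G,w\rangle_{L^2}\quad\text{in }\mathscr D'((0,T))\text{ for all }w\in\widetilde H^s(\Omega).$$ For $F\in L^2(0,T;H^{-s}(\Omega))$, $u_0\in\widetilde L^2(\Omega)$ and $u_1\in H^{-s}(\Omega)$, a very weak solution of $$\partial_t^2u+(-\Delta)^su=F\ \text{ in }\Omega\times(0,T),\qquad u=0\ \text{ in }(\mathbb R^n\setminus\overline\Omega)\times(0,T),\qquad u(0)=u_0,\ \partial_tu(0)=u_1\ \text{ in }\Omega\tag{1}$$ is a function $u\in C([0,T];\widetilde L^2(\Omega))\cap C^1([0,T];H^{-s}(\Omega))$ such that $$\int_0^T\langle u(t),G(t)\rangle_{L^2}\,dt=\int_0^T\langle F(t),v(t)\rangle\,dt+\langle u_1,v(0)\rangle-\langle u_0,\partial_tv(0)\rangle_{L^2}$$ for all $G\in L^2(0,T;\widetilde L^2(\Omega))$ and the corresponding weak solution $v$ of the backward problem. **Theorem.** There is a constant $C>0$, independent of the data $F,u_0,u_1$,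 such that for all $F\in L^2(0,T;H^{-s}(\Omega))$, $u_0\in\widetilde L^2(\Omega)$ and $u_1\in H^{-s}(\Omega)$ the problem (1) has a unique very weak solution $u$, and $$\|u(t)\|_{L^2(\Omega)}+\|\partial_tu(t)\|_{H^{-s}(\Omega)}\le C\big(\|u_0\|_{L^2(\Omega)}+\|u_1\|_{H^{-s}(\Omega)}+\|F\|_{L^2(0,T;H^{-s}(\Omega))}\big)\quad\text{for all }0\le t\le T.$$ -/

import Mathlib

open MeasureTheory Set Filter Topology FourierTransform
open scoped NNReal ENNReal ContDiff

noncomputable section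

namespace NonlocalWave

/-- Real-valued square integrable functions on `ℝⁿ`. -/
abbrev L2R (n : ℕ) : Type :=
  Lp ℝ 2 (volume : Measure (EuclideanSpace ℝ (Fin n)))

/-- Complex-valued square integrable functions on `ℝⁿ`. -/
abbrev L2C (n : ℕ) : Type :=
  Lp ℂ 2 (volume : Measure (EuclideanSpace ℝ (Fin n)))

/-- The `L²` Fourier transform of a real-valued function, with kernel `exp (-2πi x·ξ)`.  The
frequency variable for the kernel `exp (-i x·ξ)` is therefore `2πξ`. -/
def fourierL2 {n : ℕ} : L2R n →ₗ[ℝ] L2C n where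
  toFun u := 𝓕 (Complex.ofRealCLM.compLpL 2 volume u)
  map_add' u v := by rw [map_add, FourierAdd.fourier_add]
  map_smul' c u := by
    rw [map_smul, RingHom.id_apply]
    exact FourierSMul.fourier_smul (c : ℂ) _

/-- The norm `‖⟨D⟩^s u‖_{L²}` of `H^s(ℝⁿ)` (for `s ≥ 0`), with value `∞` if `u ∉ H^s(ℝⁿ)`. -/
def sobolevENorm {n : ℕ} (s : ℝ≥0) (u : L2R n) : ℝ≥0∞ :=
  eLpNorm (fun ξ : EuclideanSpace ℝ (Fin n) =>
    ((1 + (2 * Real.pi * ‖ξ‖) ^ 2) ^ ((s : ℝ) / 2) : ℝ) • fourierL2 u ξ) 2 volume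

/-- `u` is (the `L²` class of) a function in `C_c^∞(Ω)`. -/
def IsTestFun {n : ℕ} (Ω : Set (EuclideanSpace ℝ (Fin n))) (u : L2R n) : Prop :=
  ∃ φ : EuclideanSpace ℝ (Fin n) → ℝ,
    ContDiff ℝ ∞ φ ∧ HasCompactSupport φ ∧ tsupport φ ⊆ Ω ∧ u =ᵐ[volume] φ

/-- The space `C_c^∞(Ω)`, inside `L²(ℝⁿ)`. -/
def testFun {n : ℕ} (Ω : Set (EuclideanSpace ℝ (Fin n))) : Submodule ℝ (L2R n) where
  carrier := {u | IsTestFun Ω u}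
  zero_mem' := ⟨0, contDiff_const, HasCompactSupport.zero, by simp [tsupport], Lp.coeFn_zero _ _ _⟩
  add_mem' := by
    rintro u v ⟨φ, h1, h2, h3, h4⟩ ⟨ψ, k1, k2, k3, k4⟩
    refine ⟨φ + ψ, h1.add k1, h2.add k2, (tsupport_add φ ψ).trans (union_subset h3 k3), ?_⟩
    exact (Lp.coeFn_add u v).trans (h4.add k4)
  smul_mem' := by
    rintro c u ⟨φ, h1, h2, h3, h4⟩
    refine ⟨c • φ, h1.const_smul c, h2.smul_left (f := fun _ => c),
      (tsupport_smul_subset_right (fun _ => c) φ).trans h3, ?_⟩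
    exact (Lp.coeFn_smul c u).trans (h4.const_smul c)

/-- `L̃²(Ω)`: the closure of `C_c^∞(Ω)` in `L²(ℝⁿ)`, with the `L²(ℝⁿ)` inner product. -/
abbrev LTilde {n : ℕ} (Ω : Set (EuclideanSpace ℝ (Fin n))) : Submodule ℝ (L2R n) :=
  (testFun Ω).topologicalClosure

theorem aestronglyMeasurable_weight {n : ℕ} (s : ℝ≥0) :
    AEStronglyMeasurable (fun ξ : EuclideanSpace ℝ (Fin n) =>
      ((1 + (2 * Real.pi * ‖ξ‖) ^ 2) ^ ((s : ℝ) / 2) : ℝ)) volume :=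
  Measurable.aestronglyMeasurable (by fun_prop)

theorem aestronglyMeasurable_symbol {n : ℕ} (α : ℝ) :
    AEStronglyMeasurable (fun ξ : EuclideanSpace ℝ (Fin n) =>
      ((2 * Real.pi * ‖ξ‖) ^ (2 * α) : ℝ)) volume :=
  Measurable.aestronglyMeasurable (by fun_prop)

theorem sobolevENorm_add_le {n : ℕ} (s : ℝ≥0) (u v : L2R n) :
    sobolevENorm s (u + v) ≤ sobolevENorm s u + sobolevENorm s v := by
  unfold sobolevENorm
  refine le_trans (le_of_eq (eLpNorm_congr_ae ?_)) (eLpNorm_add_le ?_ ?_ (by norm_num))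
  · rw [map_add]
    filter_upwards [Lp.coeFn_add (fourierL2 u) (fourierL2 v)] with ξ hξ
    rw [hξ]; simp [smul_add]
  all_goals
    exact (aestronglyMeasurable_weight s).smul (Lp.aestronglyMeasurable _)

theorem sobolevENorm_smul {n : ℕ} (s : ℝ≥0) (c : ℝ) (u : L2R n) :
    sobolevENorm s (c • u) = ‖c‖ₑ * sobolevENorm s u := by
  unfold sobolevENorm
  rw [← eLpNorm_const_smul]
  refine eLpNorm_congr_ae ?_
  rw [map_smul]
  filter_upwards [Lp.coeFn_smul c (fourierL2 u)] with ξ hξ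
  rw [hξ]; simp only [Pi.smul_apply]; rw [smul_comm]

/-- `H̃^s(Ω)`: the closure of `C_c^∞(Ω)` in `H^s(ℝⁿ)`.  For `s ≥ 0` all elements of this closure lie
in `L̃²(Ω)`, because `‖·‖_{L²} ≤ ‖·‖_{H^s}`. -/
def HTildeSub {n : ℕ} (s : ℝ≥0) (Ω : Set (EuclideanSpace ℝ (Fin n))) :
    Submodule ℝ (LTilde Ω) where
  carrier := {u | sobolevENorm s (u : L2R n) < ⊤ ∧
    ∀ ε : ℝ≥0∞, 0 < ε → ∃ φ ∈ testFun Ω, sobolevENorm s ((u : L2R n) - φ) < ε}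
  zero_mem' := by
    have h0 : sobolevENorm s (0 : L2R n) = 0 := by
      simpa using sobolevENorm_smul s 0 (0 : L2R n)
    refine ⟨by simp [h0], fun ε hε => ⟨0, zero_mem _, by simpa [h0] using hε⟩⟩
  add_mem' := by
    rintro u v ⟨hu, hu'⟩ ⟨hv, hv'⟩
    refine ⟨(sobolevENorm_add_le s _ _).trans_lt (ENNReal.add_lt_top.2 ⟨hu, hv⟩), fun ε hε => ?_⟩
    obtain ⟨φ, hφ, h1⟩ := hu' (ε / 2) (ENNReal.half_pos hε.ne')
    obtain ⟨ψ, hψ, h2⟩ := hv' (ε / 2) (ENNReal.half_pos hε.ne')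
    refine ⟨φ + ψ, add_mem hφ hψ, ?_⟩
    have : ((u + v : LTilde Ω) : L2R n) - (φ + ψ) = ((u : L2R n) - φ) + ((v : L2R n) - ψ) := by
      rw [Submodule.coe_add]; abel
    rw [this]
    refine (sobolevENorm_add_le s _ _).trans_lt ?_
    calc _ < ε / 2 + ε / 2 := ENNReal.add_lt_add h1 h2
      _ = ε := ENNReal.add_halves ε
  smul_mem' := by
    rintro c u ⟨hu, hu'⟩
    have hc (w : L2R n) : sobolevENorm s (c • w) = ‖c‖ₑ * sobolevENorm s w := sobolevENorm_smul s c w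
    refine ⟨?_, fun ε hε => ?_⟩
    · rw [Submodule.coe_smul, hc]
      exact ENNReal.mul_lt_top (by simp) hu
    · rcases eq_or_ne c 0 with rfl | h0
      · exact ⟨0, zero_mem _, by
          have := hc 0
          simp only [zero_smul, enorm_zero, zero_mul] at this
          simpa [this] using hε⟩
      · have hc0 : ‖c‖ₑ ≠ 0 := by simpa using h0
        obtain ⟨φ, hφ, h1⟩ := hu' (ε / ‖c‖ₑ) (ENNReal.div_pos hε.ne' (by simp))
        refine ⟨c • φ, Submodule.smul_mem _ c hφ, ?_⟩
        rw [Submodule.coe_smul, ← smul_sub, hc, mul_comm]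
        exact (ENNReal.lt_div_iff_mul_lt (Or.inl hc0) (Or.inl (by simp))).1 h1

open Classical in
/-- The fractional Laplacian `(-Δ)^α u`, i.e. the Fourier multiplier `(2π|ξ|)^{2α}` in the present
normalisation of the Fourier transform, for `u` with `(2π|ξ|)^{2α} û ∈ L²` (and `0` otherwise). -/
def fracLap {n : ℕ} (α : ℝ) (u : L2R n) : L2C n :=
  if h : MemLp (fun ξ : EuclideanSpace ℝ (Fin n) =>
      ((2 * Real.pi * ‖ξ‖) ^ (2 * α) : ℝ) • fourierL2 u ξ) 2 volume
  then 𝓕⁻ (h.toLp _) else 0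

theorem memLp_of_sobolev {n : ℕ} (s : ℝ≥0) (u : L2R n) (hu : sobolevENorm s u < ⊤) :
    MemLp (fun ξ : EuclideanSpace ℝ (Fin n) =>
      ((2 * Real.pi * ‖ξ‖) ^ (2 * ((s : ℝ) / 2)) : ℝ) • fourierL2 u ξ) 2 volume := by
  refine ⟨(aestronglyMeasurable_symbol _).smul (Lp.aestronglyMeasurable _), lt_of_le_of_lt (eLpNorm_mono fun ξ => ?_) hu⟩
  rw [norm_smul, norm_smul]
  gcongr
  have h0 : 0 ≤ 2 * Real.pi * ‖ξ‖ := by positivity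
  rw [Real.norm_of_nonneg (by positivity), Real.norm_of_nonneg (by positivity),
    Real.rpow_mul h0]
  refine Real.rpow_le_rpow (by positivity) ?_ (by positivity)
  rw [Real.rpow_two]; linarith

theorem fourier_fracLap {n : ℕ} (s : ℝ≥0) (u : L2R n) (hu : sobolevENorm s u < ⊤) :
    Lp.fourierTransformₗᵢ (EuclideanSpace ℝ (Fin n)) ℂ (fracLap ((s : ℝ) / 2) u) =ᵐ[volume]
      fun ξ : EuclideanSpace ℝ (Fin n) =>
        ((2 * Real.pi * ‖ξ‖) ^ (2 * ((s : ℝ) / 2)) : ℝ) • fourierL2 u ξ := by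
  have h := memLp_of_sobolev s u hu
  rw [fracLap, dif_pos h]
  change (𝓕 (𝓕⁻ (h.toLp _) : L2C n) : L2C n) =ᵐ[volume] _
  rw [FourierTransform.fourier_fourierInv_eq]
  exact h.coeFn_toLp

theorem fracLap_add {n : ℕ} (s : ℝ≥0) (u v : L2R n) (hu : sobolevENorm s u < ⊤)
    (hv : sobolevENorm s v < ⊤) :
    fracLap ((s : ℝ) / 2) (u + v) = fracLap ((s : ℝ) / 2) u + fracLap ((s : ℝ) / 2) v := by
  apply (Lp.fourierTransformₗᵢ (EuclideanSpace ℝ (Fin n)) ℂ).injective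
  rw [map_add]
  apply Lp.ext
  have huv : sobolevENorm s (u + v) < ⊤ :=
    (sobolevENorm_add_le s u v).trans_lt (ENNReal.add_lt_top.2 ⟨hu, hv⟩)
  refine (fourier_fracLap s _ huv).trans (EventuallyEq.trans ?_ (Lp.coeFn_add _ _).symm)
  rw [map_add]
  filter_upwards [fourier_fracLap s u hu, fourier_fracLap s v hv,
    Lp.coeFn_add (fourierL2 u) (fourierL2 v)] with ξ h1 h2 h3
  rw [h3, Pi.add_apply, Pi.add_apply, h1, h2, smul_add]

theorem fracLap_smul {n : ℕ} (s : ℝ≥0) (c : ℝ) (u : L2R n) (hu : sobolevENorm s u < ⊤) :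
    fracLap ((s : ℝ) / 2) (c • u) = c • fracLap ((s : ℝ) / 2) u := by
  apply (Lp.fourierTransformₗᵢ (EuclideanSpace ℝ (Fin n)) ℂ).injective
  have hc : Lp.fourierTransformₗᵢ (EuclideanSpace ℝ (Fin n)) ℂ (c • fracLap ((s : ℝ) / 2) u) =
      c • Lp.fourierTransformₗᵢ (EuclideanSpace ℝ (Fin n)) ℂ (fracLap ((s : ℝ) / 2) u) :=
    (Lp.fourierTransformₗᵢ (EuclideanSpace ℝ (Fin n)) ℂ).map_smul (c : ℂ) _
  rw [hc]
  apply Lp.ext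
  have hcu : sobolevENorm s (c • u) < ⊤ := by
    rw [sobolevENorm_smul]; exact ENNReal.mul_lt_top (by simp) hu
  refine (fourier_fracLap s _ hcu).trans (EventuallyEq.trans ?_ (Lp.coeFn_smul _ _).symm)
  rw [map_smul]
  filter_upwards [fourier_fracLap s u hu, Lp.coeFn_smul c (fourierL2 u)] with ξ h1 h2
  rw [h2, Pi.smul_apply, Pi.smul_apply, h1, smul_comm]

theorem norm_fourierL2 {n : ℕ} (u : L2R n) : ‖fourierL2 u‖ = ‖u‖ := by
  change ‖𝓕 (Complex.ofRealCLM.compLpL 2 volume u)‖ = _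
  rw [Lp.norm_fourier_eq, Lp.norm_def, Lp.norm_def]
  congr 1
  refine eLpNorm_congr_norm_ae ?_
  filter_upwards [ContinuousLinearMap.coeFn_compLpL (p := 2) Complex.ofRealCLM u] with x hx
  rw [hx]; simp

theorem eq_zero_of_fracLap_eq_zero {n : ℕ} [NeZero n] (s : ℝ≥0) (u : L2R n)
    (hu : sobolevENorm s u < ⊤) (h : fracLap ((s : ℝ) / 2) u = 0) : u = 0 := by
  have h1 := fourier_fracLap s u hu
  rw [h, map_zero] at h1
  have h2 : fourierL2 u = 0 := by
    apply Lp.ext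
    have h0 : ∀ᵐ ξ : EuclideanSpace ℝ (Fin n) ∂volume, ξ ≠ 0 := by
      simp [ae_iff, measure_singleton]
    filter_upwards [h1, h0, Lp.coeFn_zero ℂ 2 (volume : Measure (EuclideanSpace ℝ (Fin n)))]
      with ξ k1 k2 k3
    rw [k3] at k1 ⊢
    have k4 : 0 < 2 * Real.pi * ‖ξ‖ := by
      have := norm_pos_iff.2 k2
      positivity
    have k5 : ((2 * Real.pi * ‖ξ‖) ^ (2 * ((s : ℝ) / 2)) : ℝ) ≠ 0 := (Real.rpow_pos_of_pos k4 _).ne'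
    exact (smul_eq_zero.1 k1.symm).resolve_left k5
  rw [← norm_eq_zero, ← norm_fourierL2, h2, norm_zero]

/-- `H̃^s(Ω)` as a type of its own; it carries the norm `‖(-Δ)^{s/2} u‖_{L²(ℝⁿ)}` defined below,
not the `L²` norm. -/
def HTilde {n : ℕ} (s : ℝ≥0) (Ω : Set (EuclideanSpace ℝ (Fin n))) : Type :=
  HTildeSub s Ω

instance {n : ℕ} (s : ℝ≥0) (Ω : Set (EuclideanSpace ℝ (Fin n))) :
    AddCommGroup (HTilde s Ω) :=
  inferInstanceAs (AddCommGroup (HTildeSub s Ω))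

instance {n : ℕ} (s : ℝ≥0) (Ω : Set (EuclideanSpace ℝ (Fin n))) :
    Module ℝ (HTilde s Ω) :=
  inferInstanceAs (Module ℝ (HTildeSub s Ω))

/-- The inclusion `H̃^s(Ω) ⊆ L̃²(Ω)`. -/
def toLTilde {n : ℕ} {s : ℝ≥0} {Ω : Set (EuclideanSpace ℝ (Fin n))} :
    HTilde s Ω →ₗ[ℝ] LTilde Ω :=
  (HTildeSub s Ω).subtype

/-- `u ↦ (-Δ)^{s/2} u` as a linear map from `H̃^s(Ω)` to `L²(ℝⁿ)`. -/
def halfLap {n : ℕ} {s : ℝ≥0} {Ω : Set (EuclideanSpace ℝ (Fin n))} :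
    HTilde s Ω →ₗ[ℝ] L2C n where
  toFun u := fracLap ((s : ℝ) / 2) (toLTilde u : L2R n)
  map_add' u v := fracLap_add s _ _ u.2.1 v.2.1
  map_smul' c u := fracLap_smul s c _ u.2.1

theorem halfLap_injective {n : ℕ} [NeZero n] {s : ℝ≥0} {Ω : Set (EuclideanSpace ℝ (Fin n))} :
    Function.Injective (halfLap : HTilde s Ω →ₗ[ℝ] L2C n) := by
  refine (injective_iff_map_eq_zero _).2 fun u hu => ?_
  exact Subtype.ext (Subtype.ext (eq_zero_of_fracLap_eq_zero s _ u.2.1 hu))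

/-- The norm `‖u‖ = ‖(-Δ)^{s/2} u‖_{L²(ℝⁿ)}` on `H̃^s(Ω)`. -/
instance {n : ℕ} [NeZero n] (s : ℝ≥0) (Ω : Set (EuclideanSpace ℝ (Fin n))) :
    NormedAddCommGroup (HTilde s Ω) :=
  NormedAddCommGroup.induced (HTilde s Ω) (L2C n) halfLap halfLap_injective

instance {n : ℕ} [NeZero n] (s : ℝ≥0) (Ω : Set (EuclideanSpace ℝ (Fin n))) :
    NormedSpace ℝ (HTilde s Ω) :=
  NormedSpace.induced ℝ (HTilde s Ω) (L2C n) halfLap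

/-- The inner product `⟨(-Δ)^{s/2} u, (-Δ)^{s/2} v⟩_{L²(ℝⁿ)}` of `H̃^s(Ω)`.  For real-valued `u`, `v`
it is real; the real part only serves to obtain a real number from Mathlib's complex inner
product. -/
def innerHTilde {n : ℕ} {s : ℝ≥0} {Ω : Set (EuclideanSpace ℝ (Fin n))} (u v : HTilde s Ω) : ℝ :=
  (inner ℂ (halfLap u) (halfLap v)).re

/-- `H^{-s}(Ω)`, as the dual space of `H̃^s(Ω)` with the dual norm. -/
abbrev HNeg {n : ℕ} [NeZero n] (s : ℝ≥0) (Ω : Set (EuclideanSpace ℝ (Fin n))) : Type :=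
  StrongDual ℝ (HTilde s Ω)

theorem fourierL2_test_bound {n : ℕ} (Ω B : Set (EuclideanSpace ℝ (Fin n)))
    (u : L2R n) (hu : u ∈ testFun Ω) :
    eLpNorm (fourierL2 u) 2 (volume.restrict B) ≤
      volume B ^ (1 / 2 : ℝ) * (‖u‖ₑ * volume Ω ^ (1 / 2 : ℝ)) := by
  obtain ⟨φ, h1, h2, h3, h4⟩ := hu
  have g1 : ContDiff ℝ ∞ (fun x => (φ x : ℂ)) := Complex.ofRealCLM.contDiff.comp h1
  have g2 : HasCompactSupport (fun x => (φ x : ℂ)) := h2.comp_left (g := Complex.ofReal) rfl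
  set f := g2.toSchwartzMap g1 with hf
  have hfφ : ∀ x, f x = φ x := fun x => rfl
  have e1 : Complex.ofRealCLM.compLpL 2 volume u = f.toLp 2 := by
    apply Lp.ext
    filter_upwards [ContinuousLinearMap.coeFn_compLpL (p := 2) Complex.ofRealCLM u,
      f.coeFn_toLp 2, h4] with x k1 k2 k3
    rw [k1, k2, k3, hfφ]; rfl
  obtain ⟨g, hg⟩ : ∃ g : SchwartzMap (EuclideanSpace ℝ (Fin n)) ℂ, g = 𝓕 f := ⟨_, rfl⟩
  have e2 : fourierL2 u = g.toLp 2 := by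
    change 𝓕 (Complex.ofRealCLM.compLpL 2 volume u) = _
    rw [e1, SchwartzMap.toLp_fourier_eq, hg]
  have e3 : eLpNorm f 1 volume ≤ ‖u‖ₑ * volume Ω ^ (1 / 2 : ℝ) := by
    have k1 : eLpNorm f 1 volume = eLpNorm f 1 (volume.restrict Ω) := by
      rw [eLpNorm_one_eq_lintegral_enorm, eLpNorm_one_eq_lintegral_enorm]
      refine (setLIntegral_eq_of_support_subset ?_).symm
      intro x hx
      refine h3 (subset_tsupport φ ?_)
      intro h0
      apply hx
      simp [hfφ, h0]
    have k2 : eLpNorm f 2 (volume.restrict Ω) ≤ ‖u‖ₑ := by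
      refine (eLpNorm_mono_measure _ Measure.restrict_le_self).trans (le_of_eq ?_)
      rw [Lp.enorm_def]
      refine eLpNorm_congr_norm_ae ?_
      filter_upwards [h4] with x hx
      rw [hx, hfφ]; simp
    rw [k1]
    refine (eLpNorm_le_eLpNorm_mul_rpow_measure_univ (q := 2) (by norm_num)
      f.continuous.aestronglyMeasurable).trans ?_
    rw [Measure.restrict_apply_univ]
    have : (1 / (1 : ℝ≥0∞).toReal - 1 / (2 : ℝ≥0∞).toReal) = (1 / 2 : ℝ) := by norm_num
    rw [this]
    gcongr
  have e4 : ∀ ξ, ‖g ξ‖ₑ ≤ eLpNorm f 1 volume := by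
    intro ξ
    rw [eLpNorm_one_eq_lintegral_enorm, hg, SchwartzMap.fourier_coe, Real.fourier_eq]
    refine (enorm_integral_le_lintegral_enorm _).trans (le_of_eq ?_)
    congr 1; ext x
    simp [← ofReal_norm]
  have e6 : ((fourierL2 u : L2C n) : EuclideanSpace ℝ (Fin n) → ℂ) =ᵐ[volume.restrict B] g := by
    rw [e2]
    exact ae_restrict_of_ae (g.coeFn_toLp 2 volume)
  rw [eLpNorm_congr_ae e6]
  generalize eLpNorm f 1 volume = M at e3 e4
  have e5 : eLpNorm g 2 (volume.restrict B) ≤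
      eLpNorm (fun _ : EuclideanSpace ℝ (Fin n) => M) 2 (volume.restrict B) :=
    eLpNorm_mono_enorm fun ξ => e4 ξ
  refine e5.trans ?_
  rw [eLpNorm_const' _ (by norm_num) (by norm_num), Measure.restrict_apply_univ, mul_comm]
  rw [enorm_eq_self, ENNReal.toReal_ofNat]
  exact mul_le_mul_right e3 _

theorem fourierL2_bound {n : ℕ} (Ω B : Set (EuclideanSpace ℝ (Fin n)))
    (hB : volume B ^ (1 / 2 : ℝ) * volume Ω ^ (1 / 2 : ℝ) ≤ 2⁻¹)
    (u : LTilde Ω) :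
    eLpNorm (fourierL2 (u : L2R n)) 2 (volume.restrict B) ≤ 2⁻¹ * ‖(u : L2R n)‖ₑ := by
  have key : ∀ w : L2R n, w ∈ (testFun Ω).topologicalClosure →
      ‖LpToLpRestrictCLM (EuclideanSpace ℝ (Fin n)) ℂ ℝ volume 2 B (fourierL2 w)‖ₑ ≤
        2⁻¹ * ‖w‖ₑ := by
    have hcl : IsClosed {w : L2R n |
        ‖LpToLpRestrictCLM (EuclideanSpace ℝ (Fin n)) ℂ ℝ volume 2 B (fourierL2 w)‖ₑ ≤
          2⁻¹ * ‖w‖ₑ} := by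
      have hF : Continuous (fourierL2 : L2R n →ₗ[ℝ] L2C n) :=
        (fourierL2.mkContinuous 1 fun w => by rw [norm_fourierL2, one_mul]).continuous
      refine isClosed_le ?_ ?_
      · exact (((LpToLpRestrictCLM (EuclideanSpace ℝ (Fin n)) ℂ ℝ volume 2 B).continuous).comp
          hF).enorm
      · exact (ENNReal.continuous_const_mul (by norm_num)).comp continuous_enorm
    intro w hw
    refine closure_minimal (s := (testFun Ω : Set (L2R n))) ?_ hcl hw
    intro φ hφ
    have h1 := fourierL2_test_bound Ω B φ hφ
    rw [Set.mem_ofPred_eq]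
    rw [Lp.enorm_def, eLpNorm_congr_ae (LpToLpRestrictCLM_coeFn ℝ B (fourierL2 φ))]
    refine h1.trans ?_
    calc _ = (volume B ^ (1 / 2 : ℝ) * volume Ω ^ (1 / 2 : ℝ)) * ‖φ‖ₑ := by ring
      _ ≤ _ := by gcongr
  have := key u u.2
  rwa [Lp.enorm_def, eLpNorm_congr_ae (LpToLpRestrictCLM_coeFn ℝ B _)] at this

/-- Poincaré inequality on bounded sets. -/
theorem poincare {n : ℕ} [NeZero n] {s : ℝ≥0} {Ω : Set (EuclideanSpace ℝ (Fin n))}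
    (hΩ : Bornology.IsBounded Ω) :
    ∃ C : ℝ, ∀ u : HTilde s Ω, ‖toLTilde u‖ ≤ C * ‖u‖ := by
  have hΩ' : volume Ω ≠ ⊤ := hΩ.measure_lt_top.ne
  obtain ⟨r, hr, hB⟩ : ∃ r : ℝ, 0 < r ∧
      volume (Metric.ball (0 : EuclideanSpace ℝ (Fin n)) r) ^ (1 / 2 : ℝ) *
        volume Ω ^ (1 / 2 : ℝ) ≤ 2⁻¹ := by
    have ht : Tendsto (fun r : ℝ => volume (Metric.ball (0 : EuclideanSpace ℝ (Fin n)) r) ^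
        (1 / 2 : ℝ) * volume Ω ^ (1 / 2 : ℝ)) (𝓝[>] 0) (𝓝 0) := by
      have h0 : Tendsto (fun r : ℝ => volume (Metric.ball (0 : EuclideanSpace ℝ (Fin n)) r))
          (𝓝[>] 0) (𝓝 0) := by
        have h1 : Tendsto (fun r : ℝ => ENNReal.ofReal (r ^ n) *
            volume (Metric.ball (0 : EuclideanSpace ℝ (Fin n)) 1)) (𝓝 0) (𝓝 0) := by
          have h2 : Tendsto (fun r : ℝ => ENNReal.ofReal (r ^ n)) (𝓝 0) (𝓝 0) := by
            have h3 : Continuous (fun r : ℝ => ENNReal.ofReal (r ^ n)) :=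
              ENNReal.continuous_ofReal.comp (continuous_pow n)
            simpa [NeZero.ne n] using h3.tendsto 0
          simpa using ENNReal.Tendsto.mul_const h2 (Or.inr measure_ball_lt_top.ne)
        refine (h1.mono_left nhdsWithin_le_nhds).congr' ?_
        filter_upwards [self_mem_nhdsWithin] with r hr
        rw [Measure.addHaar_ball_of_pos _ _ hr, finrank_euclideanSpace_fin]
      have h1 := (ENNReal.continuous_rpow_const (y := 1 / 2)).tendsto 0 |>.comp h0
      rw [ENNReal.zero_rpow_of_pos (by norm_num)] at h1
      simpa using ENNReal.Tendsto.mul_const h1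
        (Or.inr (ENNReal.rpow_ne_top_of_nonneg (by norm_num) hΩ'))
    have h2 := (ht.eventually_le_const (u := 2⁻¹) (by norm_num)).and self_mem_nhdsWithin
    obtain ⟨r, h3, h4⟩ := h2.exists
    exact ⟨r, h4, h3⟩
  set B := Metric.ball (0 : EuclideanSpace ℝ (Fin n)) r with hBdef
  have hc : 0 < (2 * Real.pi * r) ^ (s : ℝ) := Real.rpow_pos_of_pos (by positivity) _
  refine ⟨2 * ((2 * Real.pi * r) ^ (s : ℝ))⁻¹, fun u => ?_⟩
  set U : L2R n := (toLTilde u : L2R n) with hU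
  have h1 : eLpNorm (fourierL2 U) 2 (volume.restrict B) ≤ 2⁻¹ * ‖U‖ₑ :=
    fourierL2_bound Ω B hB (toLTilde u)
  have h2 : eLpNorm (fourierL2 U) 2 (volume.restrict Bᶜ) ≤
      ENNReal.ofReal ((2 * Real.pi * r) ^ (s : ℝ))⁻¹ * ‖halfLap u‖ₑ := by
    have k0 : ‖halfLap u‖ₑ =
        ‖Lp.fourierTransformₗᵢ (EuclideanSpace ℝ (Fin n)) ℂ (halfLap u)‖ₑ := by
      rw [← ofReal_norm, ← ofReal_norm, LinearIsometryEquiv.norm_map]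
    rw [k0, Lp.enorm_def]
    refine le_trans ?_ (mul_le_mul_right (eLpNorm_mono_measure _
      (Measure.restrict_le_self (s := Bᶜ))) _)
    refine eLpNorm_le_mul_eLpNorm_of_ae_le_mul ?_ 2
    filter_upwards [ae_restrict_of_ae (fourier_fracLap s U u.2.1),
      ae_restrict_mem (Metric.isOpen_ball.measurableSet.compl)] with ξ k1 k2
    have k3 : r ≤ ‖ξ‖ := by simpa [hBdef] using k2
    have k4 : (2 * Real.pi * r) ^ (s : ℝ) ≤ (2 * Real.pi * ‖ξ‖) ^ (2 * ((s : ℝ) / 2)) := by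
      rw [mul_div_cancel₀ _ (two_ne_zero' ℝ)]
      gcongr
    change _ ≤ _ * ‖(Lp.fourierTransformₗᵢ (EuclideanSpace ℝ (Fin n)) ℂ
      (fracLap ((s : ℝ) / 2) U)) ξ‖
    rw [k1, norm_smul, Real.norm_of_nonneg (hc.le.trans k4), ← mul_assoc]
    refine le_mul_of_one_le_left (norm_nonneg _) ?_
    rw [inv_mul_eq_div, one_le_div hc]
    exact k4
  have h3 : ‖U‖ ≤ 2⁻¹ * ‖U‖ + ((2 * Real.pi * r) ^ (s : ℝ))⁻¹ * ‖u‖ := by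
    have k1 : ‖U‖ₑ ≤ 2⁻¹ * ‖U‖ₑ + ENNReal.ofReal ((2 * Real.pi * r) ^ (s : ℝ))⁻¹ * ‖halfLap u‖ₑ := by
      have k2 : ‖U‖ₑ = eLpNorm (fourierL2 U) 2 volume := by
        rw [← Lp.enorm_def, ← ofReal_norm, ← ofReal_norm, norm_fourierL2]
      have hm : MeasurableSet B := Metric.isOpen_ball.measurableSet
      have k3 : eLpNorm (fourierL2 U) 2 volume ≤ eLpNorm (fourierL2 U) 2 (volume.restrict B) +
          eLpNorm (fourierL2 U) 2 (volume.restrict Bᶜ) := by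
        rw [← eLpNorm_indicator_eq_eLpNorm_restrict hm,
          ← eLpNorm_indicator_eq_eLpNorm_restrict hm.compl]
        have k4 := Set.indicator_self_add_compl B (fourierL2 U : EuclideanSpace ℝ (Fin n) → ℂ)
        conv_lhs => rw [← k4]
        exact eLpNorm_add_le ((Lp.aestronglyMeasurable _).indicator hm)
          ((Lp.aestronglyMeasurable _).indicator hm.compl) (by norm_num)
      rw [k2]
      refine k3.trans ?_
      rw [← k2]
      exact add_le_add h1 h2
    have k5 : ‖u‖ = ‖halfLap u‖ := rfl
    rw [k5]
    have e1 : (2⁻¹ : ℝ≥0∞) = ENNReal.ofReal 2⁻¹ := by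
      rw [ENNReal.ofReal_inv_of_pos (by norm_num)]; norm_num
    rw [← ofReal_norm, ← ofReal_norm, e1, ← ENNReal.ofReal_mul (by norm_num),
      ← ENNReal.ofReal_mul (by positivity), ← ENNReal.ofReal_add (by positivity) (by positivity),
      ENNReal.ofReal_le_ofReal_iff (by positivity)] at k1
    exact k1
  change ‖U‖ ≤ _
  linarith

/-- The embedding `L̃²(Ω) ⊆ H^{-s}(Ω)`, `⟨u, w⟩ = ⟨u, w⟩_{L²}`; it is well defined by the Poincaré
inequality. -/
def toHNeg {n : ℕ} [NeZero n] (s : ℝ≥0) {Ω : Set (EuclideanSpace ℝ (Fin n))}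
    (hΩ : Bornology.IsBounded Ω) (u : LTilde Ω) : HNeg s Ω :=
  LinearMap.mkContinuousOfExistsBound ((innerₛₗ ℝ u).comp toLTilde : HTilde s Ω →ₗ[ℝ] ℝ) (by
    obtain ⟨C, hC⟩ := poincare (s := s) hΩ
    refine ⟨‖u‖ * C, fun w => (norm_inner_le_norm (𝕜 := ℝ) u (toLTilde w)).trans ?_⟩
    rw [mul_assoc]
    exact mul_le_mul_of_nonneg_left (hC w) (norm_nonneg _))

/-- `∂_t v` as an `L̃²(Ω)`-valued function on `[0,T]`, for `v : [0,T] → H̃^s(Ω)`. -/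
def dtLTilde {n : ℕ} {s : ℝ≥0} {Ω : Set (EuclideanSpace ℝ (Fin n))} (T : ℝ)
    (v : ℝ → HTilde s Ω) (t : ℝ) : LTilde Ω :=
  derivWithin (fun τ => toLTilde (v τ)) (Icc 0 T) t

/-- `∂_t u` as an `H^{-s}(Ω)`-valued function on `[0,T]`, for `u : [0,T] → L̃²(Ω)`. -/
def dtHNeg {n : ℕ} [NeZero n] (s : ℝ≥0) {Ω : Set (EuclideanSpace ℝ (Fin n))}
    (hΩ : Bornology.IsBounded Ω) (T : ℝ) (u : ℝ → LTilde Ω) (t : ℝ) : HNeg s Ω :=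
  derivWithin (fun τ => toHNeg s hΩ (u τ)) (Icc 0 T) t

/-- `v ∈ C([0,T]; H̃^s(Ω)) ∩ C¹([0,T]; L̃²(Ω))` is a weak solution of the backward problem
`∂_t² v + (-Δ)^s v = G` in `Ω × (0,T)`, `v = 0` outside `Ω`, `v(T) = ∂_t v(T) = 0`.  Functions of
time are functions on `ℝ` of which only the values on `[0,T]` matter.  The equation is
`d/dt ⟨∂_t v, w⟩ + ⟨(-Δ)^{s/2} v, (-Δ)^{s/2} w⟩ = ⟨G, w⟩` in `𝒟'((0,T))` for all `w ∈ H̃^s(Ω)`. -/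
structure IsBackwardWeakSol {n : ℕ} [NeZero n] {s : ℝ≥0} {Ω : Set (EuclideanSpace ℝ (Fin n))}
    (T : ℝ) (G : Lp (LTilde Ω) 2 (volume.restrict (Ioo 0 T))) (v : ℝ → HTilde s Ω) : Prop where
  continuousOn : ContinuousOn v (Icc 0 T)
  contDiffOn : ContDiffOn ℝ 1 (fun t => toLTilde (v t)) (Icc 0 T)
  weak_eq : ∀ (w : HTilde s Ω) (η : ℝ → ℝ), ContDiff ℝ ∞ η → HasCompactSupport η →
    tsupport η ⊆ Ioo 0 T →
    -(∫ t in Ioo 0 T, inner ℝ (dtLTilde T v t) (toLTilde w) * deriv η t) +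
        ∫ t in Ioo 0 T, innerHTilde (v t) w * η t =
      ∫ t in Ioo 0 T, inner ℝ (G t) (toLTilde w) * η t
  final : v T = 0
  dt_final : dtLTilde T v T = 0

/-- `u ∈ C([0,T]; L̃²(Ω)) ∩ C¹([0,T]; H^{-s}(Ω))` is a very weak solution of
`∂_t² u + (-Δ)^s u = F` in `Ω × (0,T)`, `u = 0` outside `Ω`, `u(0) = u₀`, `∂_t u(0) = u₁`. -/
structure IsVeryWeakSol {n : ℕ} [NeZero n] {s : ℝ≥0} {Ω : Set (EuclideanSpace ℝ (Fin n))}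
    (hΩ : Bornology.IsBounded Ω) (T : ℝ) (F : Lp (HNeg s Ω) 2 (volume.restrict (Ioo 0 T)))
    (u₀ : LTilde Ω) (u₁ : HNeg s Ω) (u : ℝ → LTilde Ω) : Prop where
  continuousOn : ContinuousOn u (Icc 0 T)
  contDiffOn : ContDiffOn ℝ 1 (fun t => toHNeg s hΩ (u t)) (Icc 0 T)
  eq : ∀ (G : Lp (LTilde Ω) 2 (volume.restrict (Ioo 0 T))) (v : ℝ → HTilde s Ω),
    IsBackwardWeakSol T G v →
    ∫ t in Ioo 0 T, inner ℝ (u t) (G t) =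
      (∫ t in Ioo 0 T, (F t) (v t)) + u₁ (v 0) - inner ℝ u₀ (dtLTilde T v 0)

end NonlocalWave

end

noncomputable section

namespace NonlocalWave

/-! Write V for H̃^s(Ω), H for L̃²(Ω) and ι : V → H for the inclusion; it is bounded by the Poincaré
inequality, injective, and of dense range. On V × H the wave operator (v, h) ↦ (h, -Av) is
unbounded, but its inverse J(f, g) = (-ι*g, ιf) is bounded, skew-adjoint and injective. Hence J⁻¹
generates a strongly continuous family of isometries U(t) (`exists_isUnitaryFlow`), the strong limit
of exp(tB) for bounded skew-adjoint B approximating J⁻¹. Everything is phrased through J, so no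
unbounded operator appears.

Both problems are solved by the Duhamel formula `mildSol` for the same U. In the backward problem
the pair (v, ∂ₜv) has forcing (0, G), and its initial value is chosen so that it vanishes at T. The
very weak problem lives one level lower: if φ, r, p are the Riesz representatives of F, u₁, ∂ₜu,
then (-p, u) is the mild solution with initial value (-r, u₀) and forcing (-φ, 0). Its squared norm
is ‖u‖² + ‖∂ₜu‖² with the H^{-s} norm on ∂ₜu, so the isometry property and Cauchy-Schwarz in time
give the estimate. Pairing the two mild solutions and integrating by parts
(`IsUnitaryFlow.integral_inner_mildSol`) gives exactly the duality identity.

That identity is required for every weak solution v, not only for the mild one, so uniqueness for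
the backward problem is needed as well (`IsWeakWave.eq_zero`). Uniqueness of u follows by taking for
G the difference of two very weak solutions, which is possible because the backward problem is
solvable for every G. -/

theorem cauchySeq_apply_of_dense {E : Type*} [NormedAddCommGroup E] [NormedSpace ℝ E]
    {U : ℕ → E →L[ℝ] E} (hU : ∀ n x, ‖U n x‖ = ‖x‖) {D : Set E}
    (hD : Dense D) (h : ∀ x ∈ D, CauchySeq fun n => U n x) (x : E) :
    CauchySeq fun n => U n x := by
  rw [Metric.cauchySeq_iff]
  intro ε hε
  obtain ⟨y, hy, hxy⟩ := hD.exists_dist_lt x (ε := ε / 3) (by positivity)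
  obtain ⟨N, hN⟩ := Metric.cauchySeq_iff.1 (h y hy) (ε / 3) (by positivity)
  refine ⟨N, fun m hm k hk => ?_⟩
  have hd (n : ℕ) : dist (U n x) (U n y) = dist x y := by
    rw [dist_eq_norm, ← map_sub, hU, dist_eq_norm]
  calc dist (U m x) (U k x) ≤ dist (U m x) (U m y) + dist (U m y) (U k y) +
      dist (U k y) (U k x) := dist_triangle4 _ _ _ _
    _ < ε / 3 + ε / 3 + ε / 3 := by
      rw [dist_comm (U k y), hd, hd]
      linarith [hN m hm k hk]
    _ = ε := by ring

/-! ### Isometric flows generated by the inverse of a skew-adjoint operator -/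

section UnitaryFlow

variable {E : Type*} [NormedAddCommGroup E] [InnerProductSpace ℝ E] [CompleteSpace E]

theorem star_exp_smul_of_mem_skewAdjoint {B : E →L[ℝ] E} (hB : B ∈ skewAdjoint (E →L[ℝ] E))
    (t : ℝ) : star (NormedSpace.exp (t • B)) = NormedSpace.exp ((-t) • B) := by
  let _ : NormedAlgebra ℚ (E →L[ℝ] E) := NormedAlgebra.restrictScalars ℚ ℝ (E →L[ℝ] E)
  rw [NormedSpace.star_exp, star_smul, skewAdjoint.mem_iff.1 hB]
  simp

theorem inner_exp_smul_apply {B : E →L[ℝ] E} (hB : B ∈ skewAdjoint (E →L[ℝ] E)) (t : ℝ)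
    (x y : E) :
    inner ℝ (NormedSpace.exp (t • B) x) y = inner ℝ x (NormedSpace.exp ((-t) • B) y) := by
  rw [← star_exp_smul_of_mem_skewAdjoint hB, ContinuousLinearMap.star_eq_adjoint,
    ContinuousLinearMap.adjoint_inner_right]

theorem norm_exp_smul_apply {B : E →L[ℝ] E} (hB : B ∈ skewAdjoint (E →L[ℝ] E)) (t : ℝ) (x : E) :
    ‖NormedSpace.exp (t • B) x‖ = ‖x‖ := by
  let _ : NormedAlgebra ℚ (E →L[ℝ] E) := NormedAlgebra.restrictScalars ℚ ℝ (E →L[ℝ] E)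
  have h1 : Commute ((-t) • B) (t • B) := ((Commute.refl B).smul_left _).smul_right _
  have h2 : NormedSpace.exp ((-t) • B) (NormedSpace.exp (t • B) x) = x := by
    rw [← mul_apply_eq_comp, ← NormedSpace.exp_add_of_commute h1, ← add_smul, neg_add_cancel,
      zero_smul, NormedSpace.exp_zero, one_apply_eq_self]
  have h3 := inner_exp_smul_apply hB t x (NormedSpace.exp (t • B) x)
  rw [h2, real_inner_self_eq_norm_sq, real_inner_self_eq_norm_sq] at h3
  exact (sq_eq_sq₀ (norm_nonneg _) (norm_nonneg _)).1 h3

theorem hasDerivAt_exp_smul_apply (B : E →L[ℝ] E) (x : E) (t : ℝ) :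
    HasDerivAt (fun s : ℝ => NormedSpace.exp (s • B) x) (NormedSpace.exp (t • B) (B x)) t :=
  ((ContinuousLinearMap.apply ℝ E x).hasFDerivAt.comp_hasDerivAt t
    (hasDerivAt_exp_smul_const B t) :)

/-- The derivative exp(rB)Bx has constant norm ‖Bx‖, so the mean value inequality gives a Lipschitz
bound that does not involve the operator norm of B. -/
theorem norm_exp_smul_apply_sub_le {B : E →L[ℝ] E} (hB : B ∈ skewAdjoint (E →L[ℝ] E)) (s t : ℝ)
    (x : E) :
    ‖NormedSpace.exp (t • B) x - NormedSpace.exp (s • B) x‖ ≤ ‖B x‖ * |t - s| :=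
  convex_univ.norm_image_sub_le_of_norm_hasDerivWithin_le
    (fun r _ => (hasDerivAt_exp_smul_apply B x r).hasDerivWithinAt)
    (fun r _ => (norm_exp_smul_apply hB r _).le) (mem_univ s) (mem_univ t)

/-- Bounded skew-adjoint approximations of the inverse of a skew-adjoint operator. -/
theorem exists_skewAdjoint_approx_inverse {J : E →L[ℝ] E} (hJ : J ∈ skewAdjoint (E →L[ℝ] E))
    {ε : ℝ} (hε : 0 < ε) :
    ∃ B ∈ skewAdjoint (E →L[ℝ] E), (∀ A : E →L[ℝ] E, Commute A J → Commute A B) ∧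
      (∀ x, ‖B (J x)‖ ≤ ‖x‖) ∧ ∀ x, 2 * ‖B (J (J x)) - J x‖ ^ 2 ≤ ε * ‖x‖ ^ 2 := by
  have hJs : star J = -J := skewAdjoint.mem_iff.1 hJ
  have hin (x y : E) : inner ℝ (J x) y = -inner ℝ x (J y) := by
    rw [← ContinuousLinearMap.adjoint_inner_right, ← ContinuousLinearMap.star_eq_adjoint, hJs]
    simp
  -- With R = (ε - J²)⁻¹, the approximation of J⁻¹ is B = -JR, since BJ = -J²R should tend to 1 as ε
  -- → 0. The operator ε - J² is invertible because ⟨(ε - J²)x, x⟩ = ε‖x‖² + ‖Jx‖².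
  obtain ⟨S, hS⟩ : ∃ S : E →L[ℝ] E, S = ε • 1 - J * J := ⟨_, rfl⟩
  have hSa (w : E) : S w = ε • w - J (J w) := by simp [hS]
  have hSu : IsUnit S := by
    refine ContinuousLinearMap.isUnit_of_forall_le_norm_inner_map S (c := ⟨ε, hε.le⟩) hε
      fun x => ?_
    have : inner ℝ (S x) x = ε * ‖x‖ ^ 2 + ‖J x‖ ^ 2 := by
      rw [hSa, inner_sub_left, real_inner_smul_left, real_inner_self_eq_norm_sq, hin,
        real_inner_self_eq_norm_sq]
      ring
    rw [this, Real.norm_of_nonneg (by positivity)]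
    change ‖x‖ ^ 2 * ε ≤ _
    nlinarith [sq_nonneg ‖J x‖]
  obtain ⟨S', rfl⟩ := hSu
  obtain ⟨R, hR⟩ : ∃ R : E →L[ℝ] E, R = ↑S'⁻¹ := ⟨_, rfl⟩
  have hcomm (A : E →L[ℝ] E) (hA : Commute A J) : Commute A R := by
    rw [hR]
    refine Commute.units_inv_right ?_
    rw [hS]
    exact ((Commute.one_right A).smul_right ε).sub_right (hA.mul_right hA)
  have hSR (x : E) : ε • R x - J (J (R x)) = x := by
    rw [← hSa, hR, ← mul_apply_eq_comp, Units.mul_inv, one_apply_eq_self]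
  have hJR (x : E) : J (R x) = R (J x) := by
    rw [← mul_apply_eq_comp, (hcomm J (Commute.refl J)).eq,
      mul_apply_eq_comp]
  have hRs : star R = R := by
    have h1 : star (S' : E →L[ℝ] E) = S' := by
      rw [hS, star_sub, star_smul, star_one, star_mul, hJs, neg_mul_neg]
      simp
    have h2 : star S' = S' := Units.ext (by rw [Units.coe_star, h1])
    rw [hR, ← Units.coe_star, star_inv, h2]
  -- Expansion of ‖(ε - J²)Rx‖²; the cross term has a good sign because ⟨Rx, J²Rx⟩ = -‖JRx‖². Both
  -- remaining bounds are read off from this identity.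
  have hid (x : E) : ‖x‖ ^ 2 = ε ^ 2 * ‖R x‖ ^ 2 + 2 * ε * ‖J (R x)‖ ^ 2 + ‖J (J (R x))‖ ^ 2 := by
    conv_lhs => rw [← hSR x]
    rw [norm_sub_sq_real, norm_smul, real_inner_smul_left, Real.norm_of_nonneg hε.le]
    have := hin (R x) (J (R x))
    rw [real_inner_self_eq_norm_sq] at this
    linear_combination (-2 * ε) * this
  have hBJ (x : E) : (-(J * R)) (J x) = -J (J (R x)) := by
    simp [hJR]
  refine ⟨-(J * R), ?_, fun A hA => (hA.mul_right (hcomm A hA)).neg_right, fun x => ?_,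
    fun x => ?_⟩
  · rw [skewAdjoint.mem_iff, star_neg, star_mul, hRs, hJs, mul_neg,
      (hcomm J (Commute.refl J)).eq]
  · rw [hBJ, norm_neg]
    refine le_of_sq_le_sq ?_ (norm_nonneg _)
    rw [hid x]
    have : 0 ≤ ε ^ 2 * ‖R x‖ ^ 2 + 2 * ε * ‖J (R x)‖ ^ 2 := by positivity
    linarith
  -- The error is -εJRx, and the middle term of the identity gives 2ε‖JRx‖² ≤ ‖x‖².
  · have h1 : (-(J * R)) (J (J x)) - J x = -(ε • J (R x)) := by
      have := hSR (J x)
      rw [← sub_eq_zero] at this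
      rw [hBJ, ← sub_eq_zero, ← this, hJR x]
      abel
    rw [h1, norm_neg, norm_smul, Real.norm_of_nonneg hε.le, hid x]
    nlinarith [mul_nonneg hε.le (add_nonneg (mul_nonneg (sq_nonneg ε) (sq_nonneg ‖R x‖))
      (sq_nonneg ‖J (J (R x))‖))]

/-- `U` is a strongly continuous family of isometries of `E` with `U(t)* = U(-t)` and generator
`J⁻¹`. -/
structure IsUnitaryFlow {E : Type*} [NormedAddCommGroup E] [InnerProductSpace ℝ E]
    (J : E →L[ℝ] E) (U : ℝ → E →L[ℝ] E) : Prop where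
  zero_apply : ∀ x, U 0 x = x
  norm_apply : ∀ t x, ‖U t x‖ = ‖x‖
  inner_apply : ∀ t x y, inner ℝ (U t x) y = inner ℝ x (U (-t) y)
  continuous_apply : ∀ x, Continuous fun t => U t x
  apply_eq_add_integral : ∀ t x, U t (J x) = J x + ∫ τ in (0)..t, U τ x

/-- The orthogonal complement of the range is ker J* = ker(-J) = 0. -/
theorem denseRange_of_mem_skewAdjoint {J : E →L[ℝ] E} (hJ : J ∈ skewAdjoint (E →L[ℝ] E))
    (hinj : Function.Injective J) : DenseRange J := by
  have h : J.range.topologicalClosure = ⊤ := by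
    rw [Submodule.topologicalClosure_eq_top_iff, ContinuousLinearMap.orthogonal_range,
      ← ContinuousLinearMap.star_eq_adjoint, skewAdjoint.mem_iff.1 hJ]
    rw [LinearMap.ker_eq_bot]
    intro x y hxy
    exact hinj (by simpa using hxy)
  have := Submodule.dense_iff_topologicalClosure_eq_top.2 h
  rw [LinearMap.coe_range] at this
  exact this

/-- Yosida-type construction: the bounded approximations b n of J⁻¹ commute with each other and
converge on the range of J, so their exponentials converge strongly. The limit inherits the isometry
and adjoint relations, and the integral equation for exp(t b n) passes to the limit. -/
theorem exists_isUnitaryFlow {J : E →L[ℝ] E} (hJ : J ∈ skewAdjoint (E →L[ℝ] E))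
    (hinj : Function.Injective J) : ∃ U, IsUnitaryFlow J U := by
  have hd1 : DenseRange J := denseRange_of_mem_skewAdjoint hJ hinj
  have hd2 : DenseRange (J ∘ J) := hd1.comp hd1 J.continuous
  choose! B hB hBc hB1 hB2 using fun (ε : ℝ) (hε : 0 < ε) => exists_skewAdjoint_approx_inverse hJ hε
  obtain ⟨e, he0, he⟩ : ∃ e : ℕ → ℝ, (∀ n, 0 < e n) ∧ Tendsto e atTop (𝓝 0) :=
    ⟨fun n => 1 / ((n : ℝ) + 1), fun n => by positivity, tendsto_one_div_add_atTop_nhds_zero_nat⟩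
  obtain ⟨b, hb⟩ : ∃ b : ℕ → E →L[ℝ] E, b = fun n => B (e n) := ⟨_, rfl⟩
  have hbs (n : ℕ) : b n ∈ skewAdjoint (E →L[ℝ] E) := by rw [hb]; exact hB _ (he0 n)
  have hbJ (n : ℕ) : Commute (b n) J := by
    rw [hb]; exact (hBc _ (he0 n) J (Commute.refl J)).symm
  have hbb (m n : ℕ) : Commute (b m) (b n) := by
    have := hBc _ (he0 n) (b m) (hbJ m)
    rwa [hb] at this ⊢
  have hb1 (n : ℕ) (x : E) : ‖b n (J x)‖ ≤ ‖x‖ := by rw [hb]; exact hB1 _ (he0 n) x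
  have hb2 (x : E) : Tendsto (fun n => b n (J (J x))) atTop (𝓝 (J x)) := by
    rw [tendsto_iff_norm_sub_tendsto_zero]
    have h1 : Tendsto (fun n => √(e n * ‖x‖ ^ 2)) atTop (𝓝 0) := by
      have := (he.mul_const (‖x‖ ^ 2)).sqrt
      simpa using this
    refine squeeze_zero (fun n => norm_nonneg _) (fun n => Real.le_sqrt_of_sq_le ?_) h1
    have h2 := hB2 _ (he0 n) x
    rw [hb]
    nlinarith [sq_nonneg ‖B (e n) (J (J x)) - J x‖]
  -- The operators b n ∘ J are contractions, so convergence on the dense range of J extends to all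
  -- of E.
  have hb3 (x : E) : Tendsto (fun n => b n (J x)) atTop (𝓝 x) := by
    rw [Metric.tendsto_atTop]
    intro ε hε
    obtain ⟨y, hxy⟩ := hd1.exists_dist_lt x (ε := ε / 3) (by positivity)
    obtain ⟨N, hN⟩ := Metric.tendsto_atTop.1 (hb2 y) (ε / 3) (by positivity)
    refine ⟨N, fun n hn => ?_⟩
    have h1 : dist (b n (J x)) (b n (J (J y))) ≤ dist x (J y) := by
      rw [dist_eq_norm, ← map_sub, ← map_sub, dist_eq_norm]
      exact hb1 n _
    calc dist (b n (J x)) x ≤ dist (b n (J x)) (b n (J (J y))) + dist (b n (J (J y))) (J y) +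
        dist (J y) x := dist_triangle4 _ _ _ _
      _ < ε / 3 + ε / 3 + ε / 3 := by
        rw [dist_comm (J y)]
        linarith [hN n hn]
      _ = ε := by ring
  obtain ⟨W, hW⟩ : ∃ W : ℕ → ℝ → E →L[ℝ] E, W = fun n t => NormedSpace.exp (t • b n) := ⟨_, rfl⟩
  have hWn (n : ℕ) (t : ℝ) (x : E) : ‖W n t x‖ = ‖x‖ := by
    rw [hW]; exact norm_exp_smul_apply (hbs n) t x
  have hWi (n : ℕ) (t : ℝ) (x y : E) : inner ℝ (W n t x) y = inner ℝ x (W n (-t) y) := by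
    rw [hW]; exact inner_exp_smul_apply (hbs n) t x y
  -- Since b m and b n commute, exp(t b m) = exp(t b n) exp(t(b m - b n)); the isometry drops out
  -- and leaves the Lipschitz bound for the skew-adjoint difference.
  have hWdiff (m n : ℕ) (t : ℝ) (x : E) : ‖W m t x - W n t x‖ ≤ ‖b m x - b n x‖ * |t| := by
    let _ : NormedAlgebra ℚ (E →L[ℝ] E) := NormedAlgebra.restrictScalars ℚ ℝ (E →L[ℝ] E)
    have h1 : t • b m = t • b n + t • (b m - b n) := by rw [smul_sub]; abel
    have h2 : Commute (t • b n) (t • (b m - b n)) :=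
      (((hbb n m).sub_right (Commute.refl _)).smul_left t).smul_right t
    have h3 : W m t x = W n t (NormedSpace.exp (t • (b m - b n)) x) := by
      simp only [hW]
      rw [h1, NormedSpace.exp_add_of_commute h2, mul_apply_eq_comp]
    rw [h3, ← map_sub, hWn]
    simpa using norm_exp_smul_apply_sub_le (sub_mem (hbs m) (hbs n)) 0 t x
  -- On the range of J² the sequence b n converges, so the preceding bound gives a Cauchy sequence
  -- there; isometry and density give the rest.
  have hWc (t : ℝ) (x : E) : CauchySeq fun n => W n t x := by
    refine cauchySeq_apply_of_dense (fun n => hWn n t) hd2 ?_ x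
    rintro _ ⟨x, rfl⟩
    have h1 := (hb2 x).cauchySeq
    rw [Metric.cauchySeq_iff] at h1 ⊢
    intro ε hε
    obtain ⟨N, hN⟩ := h1 (ε / (|t| + 1)) (by positivity)
    refine ⟨N, fun m hm k hk => ?_⟩
    have h2 := hN m hm k hk
    rw [dist_eq_norm, lt_div_iff₀ (by positivity)] at h2
    rw [dist_eq_norm]
    refine (hWdiff m k t _).trans_lt (lt_of_le_of_lt ?_ h2)
    exact mul_le_mul_of_nonneg_left (by linarith) (norm_nonneg _)
  choose u hu using fun t x => cauchySeq_tendsto_of_complete (hWc t x)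
  have hun (t : ℝ) (x : E) : ‖u t x‖ = ‖x‖ := by
    refine tendsto_nhds_unique (hu t x).norm ?_
    simp [hWn]
  have hwu (t : ℝ) : Tendsto (fun n x => (W n t : E →ₗ[ℝ] E) x) atTop (𝓝 (u t)) :=
    tendsto_pi_nhds.2 (hu t)
  obtain ⟨U, hU⟩ : ∃ U : ℝ → E →L[ℝ] E, ∀ t x, U t x = u t x :=
    ⟨fun t => (linearMapOfTendsto (u t) (fun n => (W n t : E →ₗ[ℝ] E)) (hwu t)).mkContinuous 1
      fun x => by rw [one_mul]; exact (hun t x).le, fun t x => rfl⟩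
  have hcW (n : ℕ) (x : E) : Continuous fun t => W n t x := by
    rw [hW]
    exact continuous_iff_continuousAt.2 fun t => (hasDerivAt_exp_smul_apply _ x t).continuousAt
  have hlip (s t : ℝ) (x : E) : ‖U t (J x) - U s (J x)‖ ≤ ‖x‖ * |t - s| := by
    rw [hU, hU]
    refine le_of_tendsto ((hu t (J x)).sub (hu s (J x))).norm (Eventually.of_forall fun n => ?_)
    rw [hW]
    refine (norm_exp_smul_apply_sub_le (hbs n) s t _).trans ?_
    exact mul_le_mul_of_nonneg_right (hb1 n x) (abs_nonneg _)
  refine ⟨U, fun x => ?_, fun t x => by rw [hU, hun], fun t x y => ?_, fun x => ?_, fun t x => ?_⟩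
  · rw [hU]
    refine tendsto_nhds_unique (hu 0 x) ?_
    simp [hW]
  · rw [hU, hU]
    refine tendsto_nhds_unique ((hu t x).inner tendsto_const_nhds) ?_
    simp_rw [hWi]
    exact tendsto_const_nhds.inner (hu (-t) y)
  · refine continuous_iff_continuousAt.2 fun t => Metric.tendsto_nhds_nhds.2 fun ε hε => ?_
    obtain ⟨y, hxy⟩ := hd1.exists_dist_lt x (ε := ε / 3) (by positivity)
    refine ⟨ε / 3 / (‖y‖ + 1), by positivity, fun s hs => ?_⟩
    have hd (r : ℝ) : dist (U r x) (U r (J y)) = dist x (J y) := by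
      rw [dist_eq_norm, ← map_sub, hU, hun, dist_eq_norm]
    have h1 : dist (U s (J y)) (U t (J y)) < ε / 3 := by
      rw [lt_div_iff₀ (by positivity), Real.dist_eq] at hs
      rw [dist_eq_norm]
      refine (hlip t s y).trans_lt (lt_of_le_of_lt ?_ hs)
      nlinarith [abs_nonneg (s - t)]
    calc dist (U s x) (U t x) ≤ dist (U s x) (U s (J y)) + dist (U s (J y)) (U t (J y)) +
        dist (U t (J y)) (U t x) := dist_triangle4 _ _ _ _
      _ < ε / 3 + ε / 3 + ε / 3 := by
        rw [dist_comm (U t (J y)), hd, hd]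
        linarith
      _ = ε := by ring
  -- For the approximations this is the fundamental theorem of calculus. The integrand converges
  -- because b n (J x) → x and each W n τ is an isometry; it is dominated by ‖x‖.
  · have h1 (n : ℕ) : W n t (J x) = J x + ∫ τ in (0)..t, W n τ (b n (J x)) := by
      rw [intervalIntegral.integral_eq_sub_of_hasDerivAt (f := fun τ => W n τ (J x))]
      · simp [hW]
      · intro τ _
        rw [hW]
        exact hasDerivAt_exp_smul_apply _ _ τ
      · exact (hcW n _).intervalIntegrable _ _
    rw [hU]
    refine tendsto_nhds_unique (hu t (J x)) ?_
    simp_rw [h1]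
    refine tendsto_const_nhds.add ?_
    refine intervalIntegral.tendsto_integral_filter_of_dominated_convergence (fun _ => ‖x‖)
      (Eventually.of_forall fun n => (hcW n _).aestronglyMeasurable)
      (Eventually.of_forall fun n => Eventually.of_forall fun τ _ => ?_)
      intervalIntegrable_const (Eventually.of_forall fun τ _ => ?_)
    · rw [hWn]; exact hb1 n x
    · rw [hU]
      have h2 : Tendsto (fun n => W n τ (b n (J x)) - W n τ x) atTop (𝓝 0) := by
        rw [tendsto_zero_iff_norm_tendsto_zero]
        simp_rw [← map_sub, hWn]
        exact tendsto_iff_norm_sub_tendsto_zero.1 (hb3 x)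
      simpa using h2.add (hu τ x)

end UnitaryFlow

/-! ### Product rule for primitives and vanishing distributional derivatives -/

theorem integrableOn_inner_of_continuousOn {E : Type*} [NormedAddCommGroup E]
    [InnerProductSpace ℝ E] {a B : ℝ → E} {K : Set ℝ} (hK : IsCompact K)
    (ha : IntegrableOn a K) (hB : ContinuousOn B K) :
    IntegrableOn (fun t => inner ℝ (a t) (B t)) K := by
  obtain ⟨C, hC⟩ := hK.exists_bound_of_continuousOn hB
  refine (ha.norm.const_mul C).mono' (ha.aestronglyMeasurable.inner
    (hB.aestronglyMeasurable hK.measurableSet)) ?_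
  filter_upwards [ae_restrict_mem hK.measurableSet] with t ht
  refine (norm_inner_le_norm _ _).trans ?_
  rw [mul_comm]
  exact mul_le_mul_of_nonneg_right (hC t ht) (norm_nonneg _)

section Primitive

variable {E : Type*} [NormedAddCommGroup E] [InnerProductSpace ℝ E] [CompleteSpace E]

/-- Integration by parts for primitives of integrable functions. -/
theorem integral_inner_primitive_add {a b : ℝ → E} {T : ℝ} (hT : 0 ≤ T)
    (ha : IntervalIntegrable a volume 0 T) (hb : IntervalIntegrable b volume 0 T) :
    (∫ t in (0)..T, inner ℝ (a t) (∫ s in (0)..t, b s)) +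
      ∫ t in (0)..T, inner ℝ (∫ s in (0)..t, a s) (b t) =
      inner ℝ (∫ t in (0)..T, a t) (∫ t in (0)..T, b t) := by
  rw [intervalIntegrable_iff_integrableOn_Ioc_of_le hT] at ha hb
  obtain ⟨μ, hμ⟩ : ∃ μ : Measure ℝ, μ = volume.restrict (Ioc 0 T) := ⟨_, rfl⟩
  have hfin : SFinite μ := by rw [hμ]; infer_instance
  have ha' : Integrable a μ := by rw [hμ]; exact ha
  have hb' : Integrable b μ := by rw [hμ]; exact hb
  have hab : Integrable (fun z : ℝ × ℝ => inner ℝ (a z.1) (b z.2)) (μ.prod μ) :=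
    ha'.op_fst_snd (op := fun x y => inner ℝ x y) continuous_inner
      ⟨1, fun x y => by simpa using norm_inner_le_norm (𝕜 := ℝ) x y⟩ hb'
  -- Fubini on the square: the half {t ≤ s} gives the first integral and the complementary half {s <
  -- t} the second. The strict inequality is why open intervals appear in `e2`.
  have hm : MeasurableSet {z : ℝ × ℝ | z.2 ≤ z.1} := measurableSet_le measurable_snd measurable_fst
  have e1 : ∀ᵐ s ∂μ, ∫ t, {z : ℝ × ℝ | z.2 ≤ z.1}.indicator
      (fun z => inner ℝ (a z.1) (b z.2)) (s, t) ∂μ = inner ℝ (a s) (∫ t in (0)..s, b t) := by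
    rw [hμ]
    filter_upwards [ae_restrict_mem measurableSet_Ioc] with s hs
    have hbs : Integrable b (volume.restrict (Ioc 0 s)) :=
      hb.mono_set (Ioc_subset_Ioc_right hs.2)
    rw [intervalIntegral.integral_of_le hs.1.le, ← integral_inner hbs,
      ← integral_indicator measurableSet_Ioc, ← integral_indicator measurableSet_Ioc]
    congr 1; ext t
    simp only [indicator, mem_ofPred_eq, mem_Ioc]
    have := hs.2
    grind
  have e2 : ∀ᵐ t ∂μ, ∫ s, {z : ℝ × ℝ | z.2 ≤ z.1}ᶜ.indicator
      (fun z => inner ℝ (a z.1) (b z.2)) (s, t) ∂μ = inner ℝ (∫ s in (0)..t, a s) (b t) := by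
    rw [hμ]
    filter_upwards [ae_restrict_mem measurableSet_Ioc] with t ht
    have has : Integrable a (volume.restrict (Ioo 0 t)) :=
      ha.mono_set ((Ioo_subset_Ioc_self).trans (Ioc_subset_Ioc_right ht.2))
    rw [intervalIntegral.integral_of_le ht.1.le, integral_Ioc_eq_integral_Ioo (f := a), real_inner_comm,
      ← integral_inner has,
      ← integral_indicator measurableSet_Ioc, ← integral_indicator measurableSet_Ioo]
    congr 1; ext s
    simp only [indicator, mem_ofPred_eq, mem_Ioc, mem_compl_iff, mem_Ioo]
    have := ht.2
    have := real_inner_comm (a s) (b t)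
    grind
  have e3 : inner ℝ (∫ t, a t ∂μ) (∫ t, b t ∂μ) = ∫ s, ∫ t, inner ℝ (a s) (b t) ∂μ ∂μ := by
    rw [real_inner_comm, ← integral_inner ha']
    congr 1; ext s
    rw [real_inner_comm, ← integral_inner hb']
  rw [intervalIntegral.integral_of_le hT, intervalIntegral.integral_of_le hT,
    intervalIntegral.integral_of_le hT, intervalIntegral.integral_of_le hT, ← hμ, e3,
    ← integral_congr_ae e1, ← integral_congr_ae e2]
  have h1 := hab.indicator hm
  have h2 := hab.indicator hm.compl
  rw [← integral_prod _ h1, ← integral_prod_symm _ h2,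
    ← integral_prod _ hab, ← integral_add h1 h2]
  congr 1; ext z
  exact congrFun (indicator_self_add_compl _ _) z

/-- The product rule in integrated form. The factors are primitives of merely integrable functions,
so it rests on Fubini rather than on pointwise derivatives. -/
theorem inner_add_primitive_sub {a b : ℝ → E} {T : ℝ} (hT : 0 ≤ T) (p q : E)
    (ha : IntervalIntegrable a volume 0 T) (hb : IntervalIntegrable b volume 0 T) :
    inner ℝ (p + ∫ t in (0)..T, a t) (q + ∫ t in (0)..T, b t) - inner ℝ p q =
      (∫ t in (0)..T, inner ℝ (a t) (q + ∫ s in (0)..t, b s)) +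
      ∫ t in (0)..T, inner ℝ (p + ∫ s in (0)..t, a s) (b t) := by
  have hca : ContinuousOn (fun t => ∫ s in (0)..t, a s) (uIcc 0 T) :=
    intervalIntegral.continuousOn_primitive_interval' ha left_mem_uIcc
  have hcb : ContinuousOn (fun t => ∫ s in (0)..t, b s) (uIcc 0 T) :=
    intervalIntegral.continuousOn_primitive_interval' hb left_mem_uIcc
  have hadd := integral_inner_primitive_add hT ha hb
  rw [uIcc_of_le hT] at hca hcb
  rw [intervalIntegrable_iff_integrableOn_Icc_of_le hT] at ha hb
  have i1 (B : ℝ → E) (hB : ContinuousOn B (Icc 0 T)) :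
      IntervalIntegrable (fun t => inner ℝ (a t) (B t)) volume 0 T := by
    rw [intervalIntegrable_iff_integrableOn_Icc_of_le hT]
    exact integrableOn_inner_of_continuousOn isCompact_Icc ha hB
  have i2 (A : ℝ → E) (hA : ContinuousOn A (Icc 0 T)) :
      IntervalIntegrable (fun t => inner ℝ (A t) (b t)) volume 0 T := by
    rw [intervalIntegrable_iff_integrableOn_Icc_of_le hT]
    simp_rw [real_inner_comm]
    exact integrableOn_inner_of_continuousOn isCompact_Icc hb hA
  simp only [inner_add_left, inner_add_right]
  rw [intervalIntegral.integral_add (i1 _ continuousOn_const) (i1 _ hcb),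
    intervalIntegral.integral_add (i2 _ continuousOn_const) (i2 _ hca)]
  have e1 : ∫ t in (0)..T, inner ℝ p (b t) = inner ℝ p (∫ t in (0)..T, b t) := by
    rw [intervalIntegral.integral_of_le hT, intervalIntegral.integral_of_le hT, integral_inner]
    exact hb.mono_set Ioc_subset_Icc_self
  have e2 : ∫ t in (0)..T, inner ℝ (a t) q = inner ℝ (∫ t in (0)..T, a t) q := by
    simp_rw [real_inner_comm q]
    rw [intervalIntegral.integral_of_le hT, intervalIntegral.integral_of_le hT, integral_inner]
    exact ha.mono_set Ioc_subset_Icc_self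
  rw [e1, e2]
  linarith

/-- A continuous function with vanishing distributional derivative is constant. -/
theorem eqOn_const_of_integral_mul_deriv_eq_zero {θ : ℝ → ℝ} {T : ℝ} (hT : 0 < T)
    (hθ : ContinuousOn θ (Icc 0 T))
    (h : ∀ η : ℝ → ℝ, ContDiff ℝ ∞ η → HasCompactSupport η → tsupport η ⊆ Ioo 0 T →
      ∫ t in Ioo 0 T, θ t * deriv η t = 0) :
    ∃ c, EqOn θ (fun _ => c) (Icc 0 T) := by
  -- A normalised bump r supported in [T/4, 3T/4]. The constant will be c = ∫ θ r.
  let ρ : ContDiffBump (T / 2) := ⟨T / 8, T / 4, by positivity, by linarith⟩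
  obtain ⟨r, hr⟩ : ∃ r, r = ρ.normed volume := ⟨_, rfl⟩
  have hr1 : ContDiff ℝ ∞ r := by rw [hr]; exact ρ.contDiff_normed
  have hr2 : HasCompactSupport r := by rw [hr]; exact ρ.hasCompactSupport_normed
  have hr3 : tsupport r ⊆ Ioo 0 T := by
    rw [hr, ρ.tsupport_normed_eq, Real.closedBall_eq_Icc]
    exact Icc_subset_Ioo (by change 0 < T / 2 - T / 4; linarith)
      (by change T / 2 + T / 4 < T; linarith)
  have hr4 : ∫ t, r t = 1 := by rw [hr]; exact ρ.integral_normed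
  have hint (ζ : ℝ → ℝ) (h0 : Continuous ζ) :
      Integrable (fun t => θ t * ζ t) (volume.restrict (Ioo 0 T)) :=
    ((hθ.mul h0.continuousOn).integrableOn_Icc).mono_set Ioo_subset_Icc_self
  refine ⟨∫ t in Ioo 0 T, θ t * r t, ?_⟩
  obtain ⟨c, hc⟩ : ∃ c, c = ∫ t in Ioo 0 T, θ t * r t := ⟨_, rfl⟩
  rw [← hc]
  have hsub (ζ : ℝ → ℝ) (h3 : tsupport ζ ⊆ Ioo 0 T) : ∫ t in Ioo 0 T, ζ t = ∫ t, ζ t :=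
    setIntegral_eq_integral_of_forall_compl_eq_zero fun t ht => by
      by_contra h0
      exact ht (h3 (subset_tsupport ζ h0))
  have key : ∀ ζ : ℝ → ℝ, ContDiff ℝ ∞ ζ → HasCompactSupport ζ → tsupport ζ ⊆ Ioo 0 T →
      ∫ t in Ioo 0 T, ζ t • (θ t - c) = 0 := by
    intro ζ h1 h2 h3
    obtain ⟨k, hk⟩ : ∃ k, k = ∫ t, ζ t := ⟨_, rfl⟩
    -- Subtracting the multiple of r with the same integral leaves a function of mean zero, whose
    -- primitive η has compact support and is therefore an admissible test function.
    obtain ⟨ξ, hξ⟩ : ∃ ξ : ℝ → ℝ, ξ = fun t => ζ t - k * r t := ⟨_, rfl⟩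
    have hξ1 : ContDiff ℝ ∞ ξ := by rw [hξ]; exact h1.sub (contDiff_const.mul hr1)
    have hξ0 : ∫ t, ξ t = 0 := by
      rw [hξ, integral_sub (h1.continuous.integrable_of_hasCompactSupport h2)
        ((hr1.continuous.integrable_of_hasCompactSupport hr2).const_mul k), integral_const_mul,
        hr4, ← hk]
      ring
    -- The point T/2 makes the set visibly nonempty; its least and greatest elements then bound the
    -- support of η strictly inside (0, T).
    have hK : IsCompact (tsupport ζ ∪ tsupport r ∪ {T / 2}) :=
      (h2.isCompact.union hr2.isCompact).union isCompact_singleton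
    have hKs : tsupport ζ ∪ tsupport r ∪ {T / 2} ⊆ Ioo 0 T :=
      union_subset (union_subset h3 hr3)
        (singleton_subset_iff.2 ⟨by linarith, by linarith⟩)
    have hKn : (tsupport ζ ∪ tsupport r ∪ {T / 2}).Nonempty := ⟨T / 2, by simp⟩
    obtain ⟨x, hx, hxl⟩ := hK.exists_isLeast hKn
    obtain ⟨y, hy, hyl⟩ := hK.exists_isGreatest hKn
    have hξs (t : ℝ) (ht : t ∉ Icc x y) : ξ t = 0 := by
      have h5 : t ∉ tsupport ζ ∪ tsupport r ∪ {T / 2} := fun h6 => ht ⟨hxl h6, hyl h6⟩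
      have h6 : t ∉ tsupport ζ := fun h => h5 (Or.inl (Or.inl h))
      have h7 : t ∉ tsupport r := fun h => h5 (Or.inl (Or.inr h))
      rw [hξ]
      simp [image_eq_zero_of_notMem_tsupport h6, image_eq_zero_of_notMem_tsupport h7]
    have hxy : x ≤ y := hxl hy
    obtain ⟨η, hη⟩ : ∃ η : ℝ → ℝ, η = fun t => ∫ s in x..t, ξ s := ⟨_, rfl⟩
    have hηd (t : ℝ) : HasDerivAt η (ξ t) t := by
      rw [hη]
      exact intervalIntegral.integral_hasDerivAt_right
        (hξ1.continuous.intervalIntegrable _ _)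
        (hξ1.continuous.stronglyMeasurableAtFilter _ _) hξ1.continuous.continuousAt
    have hηd' : deriv η = ξ := funext fun t => (hηd t).deriv
    have hη1 : ContDiff ℝ ∞ η :=
      contDiff_infty_iff_deriv.2 ⟨fun t => (hηd t).differentiableAt, by rw [hηd']; exact hξ1⟩
    have hη0 (t : ℝ) (ht : t ∉ Icc x y) : η t = 0 := by
      rw [hη]
      rcases lt_or_ge t x with h5 | h5
      · simp only
        rw [intervalIntegral.integral_symm, intervalIntegral.integral_of_le h5.le,
          integral_Ioc_eq_integral_Ioo, setIntegral_eq_zero_of_forall_eq_zero, neg_zero]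
        exact fun s hs => hξs s fun h6 => absurd hs.2 (not_lt.2 h6.1)
      · have h6 : y < t := by
          by_contra h7
          exact ht ⟨h5, not_lt.1 h7⟩
        simp only
        rw [← hξ0, intervalIntegral.integral_of_le h5, ← integral_Icc_eq_integral_Ioc]
        refine setIntegral_eq_integral_of_forall_compl_eq_zero fun s hs => hξs s fun h7 => hs ?_
        exact ⟨h7.1, h7.2.trans h6.le⟩
    have hηs : tsupport η ⊆ Icc x y :=
      closure_minimal (fun t ht => by
        by_contra h5
        exact ht (hη0 t h5)) isClosed_Icc
    have h4 := h η hη1 (HasCompactSupport.of_support_subset_isCompact isCompact_Icc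
      ((subset_tsupport η).trans hηs))
      (hηs.trans (Icc_subset_Ioo (hKs hx).1 (hKs hy).2))
    rw [hηd'] at h4
    have h5 : ∫ t in Ioo 0 T, θ t * ζ t = c * k := by
      have h6 : ∫ t in Ioo 0 T, θ t * ξ t =
          (∫ t in Ioo 0 T, θ t * ζ t) - k * ∫ t in Ioo 0 T, θ t * r t := by
        rw [← integral_const_mul, ← integral_sub (hint ζ h1.continuous)
          ((hint r hr1.continuous).const_mul k)]
        congr 1; ext t; rw [hξ]; ring
      rw [h4, ← hc] at h6
      linarith
    have h6 : ∫ t in Ioo 0 T, ζ t • (θ t - c) =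
        (∫ t in Ioo 0 T, θ t * ζ t) - c * ∫ t in Ioo 0 T, ζ t := by
      rw [← integral_const_mul, ← integral_sub (hint ζ h1.continuous)
        ((h1.continuous.integrable_of_hasCompactSupport h2).restrict.const_mul c)]
      congr 1; ext t; rw [smul_eq_mul]; ring
    rw [h6, h5, hsub ζ h3, ← hk, sub_self]
  have hloc : LocallyIntegrableOn (fun t => θ t - c) (Ioo 0 T) (volume.restrict (Ioo 0 T)) := by
    refine (IntegrableOn.mono_set ?_ Ioo_subset_Icc_self).locallyIntegrableOn
    exact ((hθ.sub continuousOn_const).integrableOn_Icc).restrict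
  have h1 := isOpen_Ioo.ae_eq_zero_of_integral_contDiff_smul_eq_zero hloc key
  have h2 : θ =ᵐ[volume.restrict (Ioo 0 T)] fun _ => c := by
    filter_upwards [h1, ae_restrict_mem measurableSet_Ioo] with t h3 h4
    exact sub_eq_zero.1 (h3 h4)
  have h3 := Measure.eqOn_open_of_ae_eq h2 isOpen_Ioo (hθ.mono Ioo_subset_Icc_self)
    continuousOn_const
  exact h3.of_subset_closure hθ continuousOn_const Ioo_subset_Icc_self
    (by rw [closure_Ioo hT.ne])

end Primitive

/-! ### Mild solutions and their Green formula -/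

section Mild

variable {E : Type*} [NormedAddCommGroup E] [InnerProductSpace ℝ E]
  {J : E →L[ℝ] E} {U : ℝ → E →L[ℝ] E}

theorem IsUnitaryFlow.neg_apply_apply (hU : IsUnitaryFlow J U) (t : ℝ) (x : E) :
    U (-t) (U t x) = x := by
  have hi (r : ℝ) (x y : E) : inner ℝ (U r x) (U r y) = inner ℝ x y := by
    rw [real_inner_eq_norm_add_mul_self_sub_norm_mul_self_sub_norm_mul_self_div_two,
      real_inner_eq_norm_add_mul_self_sub_norm_mul_self_sub_norm_mul_self_div_two, ← map_add,
      hU.norm_apply, hU.norm_apply, hU.norm_apply]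
  refine ext_inner_left ℝ fun y => ?_
  rw [← hU.inner_apply, hi]

theorem IsUnitaryFlow.inner_apply_apply (hU : IsUnitaryFlow J U) (t : ℝ) (x y : E) :
    inner ℝ (U t x) (U t y) = inner ℝ x y := by
  rw [hU.inner_apply, hU.neg_apply_apply]

/-- Strong continuity upgrades to joint continuity because the U t are uniformly bounded: U t y = U
t (y - x) + U t x. -/
theorem IsUnitaryFlow.continuous_uncurry (hU : IsUnitaryFlow J U) :
    Continuous fun z : ℝ × E => U z.1 z.2 := by
  refine continuous_iff_continuousAt.2 fun z => ?_
  have h1 : Tendsto (fun w : ℝ × E => U w.1 (w.2 - z.2)) (𝓝 z) (𝓝 0) := by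
    rw [tendsto_zero_iff_norm_tendsto_zero]
    simp_rw [hU.norm_apply]
    have : Continuous fun w : ℝ × E => ‖w.2 - z.2‖ := by fun_prop
    simpa using this.tendsto z
  have h2 : Tendsto (fun w : ℝ × E => U w.1 z.2) (𝓝 z) (𝓝 (U z.1 z.2)) :=
    ((hU.continuous_apply z.2).comp continuous_fst).tendsto z
  have h3 := h1.add h2
  simp only [← map_add, sub_add_cancel, zero_add] at h3
  exact h3

theorem IsUnitaryFlow.integrable_neg_apply (hU : IsUnitaryFlow J U) {f : ℝ → E}
    (hf : Integrable f) : Integrable fun τ => U (-τ) (f τ) := by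
  refine hf.mono ?_ (Eventually.of_forall fun τ => (hU.norm_apply _ _).le)
  exact (hU.continuous_uncurry.comp (continuous_neg.prodMap continuous_id)).comp_aestronglyMeasurable
    (aestronglyMeasurable_id.prodMk hf.aestronglyMeasurable)

/-- The mild solution of `Y' = J⁻¹ Y + f`, `Y(0) = y₀`. -/
def mildSol (U : ℝ → E →L[ℝ] E) (y₀ : E) (f : ℝ → E) (t : ℝ) : E :=
  U t (y₀ + ∫ τ in (0)..t, U (-τ) (f τ))

theorem IsUnitaryFlow.continuous_mildSol (hU : IsUnitaryFlow J U) (y₀ : E) {f : ℝ → E}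
    (hf : Integrable f) : Continuous (mildSol U y₀ f) :=
  hU.continuous_uncurry.comp (continuous_id.prodMk (continuous_const.add
    ((hU.integrable_neg_apply hf).continuous_primitive 0)))

theorem IsUnitaryFlow.norm_mildSol_le (hU : IsUnitaryFlow J U) (y₀ : E) {f : ℝ → E}
    (hf : Integrable f) {t : ℝ} (ht : 0 ≤ t) : ‖mildSol U y₀ f t‖ ≤ ‖y₀‖ + ∫ τ, ‖f τ‖ := by
  rw [mildSol, hU.norm_apply]
  refine (norm_add_le _ _).trans (by
    gcongr
    rw [intervalIntegral.integral_of_le ht]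
    refine (norm_integral_le_integral_norm _).trans ?_
    simp_rw [hU.norm_apply]
    exact setIntegral_le_integral hf.norm (Eventually.of_forall fun _ => norm_nonneg _))

/-- Since both solutions carry the same isometry U t, it cancels from the inner product at time T.
What remains is the product rule for the primitives of U(-τ)f and U(-τ)g, and U(-τ)* = U(τ) restores
the mild solutions. -/
theorem IsUnitaryFlow.integral_inner_mildSol [CompleteSpace E] (hU : IsUnitaryFlow J U)
    (y₀ z₀ : E) {f g : ℝ → E}
    (hf : Integrable f) (hg : Integrable g) {T : ℝ} (hT : 0 ≤ T) :
    inner ℝ (mildSol U y₀ f T) (mildSol U z₀ g T) - inner ℝ y₀ z₀ =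
      (∫ t in (0)..T, inner ℝ (f t) (mildSol U z₀ g t)) +
        ∫ t in (0)..T, inner ℝ (mildSol U y₀ f t) (g t) := by
  have h := inner_add_primitive_sub hT y₀ z₀ (hU.integrable_neg_apply hf).intervalIntegrable
    (hU.integrable_neg_apply hg).intervalIntegrable
  simp only [mildSol]
  rw [hU.inner_apply_apply, h]
  congr 1 <;> congr 1 <;> ext t
  · rw [hU.inner_apply, neg_neg]
  · rw [hU.inner_apply]

/-- The integrated equation Y' = J⁻¹Y + f after applying J, which makes sense although Y need not be
differentiable. Tested against e, both U(t) and J move to e, and U(-t)Je is a primitive of -U(-τ)e,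
so the product rule applies. -/
theorem IsUnitaryFlow.apply_mildSol [CompleteSpace E] (hJ : J ∈ skewAdjoint (E →L[ℝ] E))
    (hU : IsUnitaryFlow J U)
    (y₀ : E) {f : ℝ → E} (hf : Integrable f) {t : ℝ} (ht : 0 ≤ t) :
    J (mildSol U y₀ f t) = J y₀ + ∫ τ in (0)..t, (mildSol U y₀ f τ + J (f τ)) := by
  have hin (x y : E) : inner ℝ (J x) y = -inner ℝ x (J y) := by
    rw [← ContinuousLinearMap.adjoint_inner_right, ← ContinuousLinearMap.star_eq_adjoint,
      skewAdjoint.mem_iff.1 hJ]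
    simp
  refine ext_inner_right ℝ fun e => ?_
  have hc (r : ℝ) : U (-r) (J e) = J e + ∫ τ in (0)..r, -U (-τ) e := by
    rw [hU.apply_eq_add_integral, intervalIntegral.integral_neg,
      intervalIntegral.integral_comp_neg (fun τ => U τ e), neg_zero,
      intervalIntegral.integral_symm]
  have hcont : Continuous fun τ => -U (-τ) e :=
    ((hU.continuous_apply e).comp continuous_neg).neg
  have h := inner_add_primitive_sub ht y₀ (J e) (hU.integrable_neg_apply hf).intervalIntegrable
    (hcont.intervalIntegrable 0 t)
  simp_rw [← hc] at h
  have h1 : IntervalIntegrable (fun τ => mildSol U y₀ f τ + J (f τ)) volume 0 t :=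
    ((hU.continuous_mildSol y₀ hf).intervalIntegrable _ _).add
      (J.integrable_comp hf).intervalIntegrable
  have h2 : inner ℝ (∫ τ in (0)..t, (mildSol U y₀ f τ + J (f τ))) e =
      ∫ τ in (0)..t, inner ℝ (mildSol U y₀ f τ + J (f τ)) e := by
    simp_rw [real_inner_comm e]
    rw [intervalIntegral.integral_of_le ht, intervalIntegral.integral_of_le ht, integral_inner]
    rwa [intervalIntegrable_iff_integrableOn_Ioc_of_le ht] at h1
  have i1 : IntervalIntegrable (fun τ => inner ℝ (mildSol U y₀ f τ) e) volume 0 t :=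
    ((hU.continuous_mildSol y₀ hf).inner continuous_const).intervalIntegrable _ _
  have i2 : IntervalIntegrable (fun τ => inner ℝ (f τ) (J e)) volume 0 t :=
    (hf.inner_const (J e)).intervalIntegrable
  rw [inner_add_left, h2, hin, hin, mildSol, hU.inner_apply]
  have h3 : ∫ τ in (0)..t, inner ℝ (mildSol U y₀ f τ + J (f τ)) e =
      (∫ τ in (0)..t, inner ℝ (mildSol U y₀ f τ) e) - ∫ τ in (0)..t, inner ℝ (f τ) (J e) := by
    rw [← intervalIntegral.integral_sub i1 i2]
    congr 1; ext τ
    rw [inner_add_left, hin]; ring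
  have h4 : ∫ τ in (0)..t, inner ℝ (U (-τ) (f τ)) (U (-τ) (J e)) =
      ∫ τ in (0)..t, inner ℝ (f τ) (J e) := by
    simp_rw [hU.inner_apply_apply]
  have h5 : ∫ τ in (0)..t, inner ℝ (y₀ + ∫ s in (0)..τ, U (-s) (f s)) (-U (-τ) e) =
      -∫ τ in (0)..t, inner ℝ (mildSol U y₀ f τ) e := by
    rw [← intervalIntegral.integral_neg]
    congr 1; ext τ
    rw [mildSol, hU.inner_apply, inner_neg_right]
  rw [h4, h5] at h
  rw [h3]
  linarith

end Mild

/-! ### Weak formulation of the abstract backward wave equation -/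

/-- The product rule for A + ∫ q and η = ∫ η'; the boundary terms vanish because η(0) = η(T) = 0. -/
theorem integral_add_primitive_mul_deriv {q η : ℝ → ℝ} {T : ℝ} (hT : 0 ≤ T)
    (hq : IntervalIntegrable q volume 0 T) (A : ℝ) (h1 : ContDiff ℝ ∞ η)
    (h3 : tsupport η ⊆ Ioo 0 T) :
    ∫ t in Ioo 0 T, (A + ∫ s in (0)..t, q s) * deriv η t = -∫ t in Ioo 0 T, q t * η t := by
  have h0 (t : ℝ) (ht : t ∉ Ioo 0 T) : η t = 0 :=
    image_eq_zero_of_notMem_tsupport fun h => ht (h3 h)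
  have hd : Continuous (deriv η) := h1.continuous_deriv (by simp)
  have hp (t : ℝ) : ∫ s in (0)..t, deriv η s = η t := by
    rw [intervalIntegral.integral_deriv_eq_sub (fun x _ => (h1.differentiable (by simp)) x)
      (hd.intervalIntegrable _ _), h0 0 (by simp), sub_zero]
  have h := inner_add_primitive_sub hT A 0 hq (hd.intervalIntegrable 0 T)
  simp only [hp, zero_add, h0 T (by simp), inner_zero_right, sub_zero] at h
  rw [intervalIntegral.integral_of_le hT, intervalIntegral.integral_of_le hT,
    integral_Ioc_eq_integral_Ioo, integral_Ioc_eq_integral_Ioo] at h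
  have e (x y : ℝ) : inner ℝ x y = x * y := by rw [real_inner_comm]; rfl
  simp only [e] at h
  linarith

section Prod

variable {V H : Type*} [NormedAddCommGroup V] [NormedAddCommGroup H]

theorem integrable_toLp_inl {φ : ℝ → V} (hφ : Integrable φ) :
    Integrable fun t => (WithLp.toLp 2 (φ t, (0 : H)) : WithLp 2 (V × H)) :=
  hφ.norm.mono' ((WithLp.prod_continuous_toLp 2 V H).comp_aestronglyMeasurable
    (hφ.aestronglyMeasurable.prodMk aestronglyMeasurable_const))
    (Eventually.of_forall fun t => (WithLp.norm_toLp_fst 2 V H (φ t)).le)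

theorem integrable_toLp_inr {G : ℝ → H} (hG : Integrable G) :
    Integrable fun t => (WithLp.toLp 2 ((0 : V), G t) : WithLp 2 (V × H)) :=
  hG.norm.mono' ((WithLp.prod_continuous_toLp 2 V H).comp_aestronglyMeasurable
    (aestronglyMeasurable_const.prodMk hG.aestronglyMeasurable))
    (Eventually.of_forall fun t => (WithLp.norm_toLp_snd 2 V H (G t)).le)

end Prod

section WeakWave

variable {V H : Type*} [NormedAddCommGroup V] [InnerProductSpace ℝ V]
  [NormedAddCommGroup H] [InnerProductSpace ℝ H]

/-- `v`, with time derivative `h`, is a weak solution of `v'' + A v = G`, `v(T) = v'(T) = 0`. -/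
structure IsWeakWave (ι : V →L[ℝ] H) (T : ℝ) (G : ℝ → H) (v : ℝ → V) (h : ℝ → H) : Prop where
  continuousOn : ContinuousOn v (Icc 0 T)
  continuousOn_deriv : ContinuousOn h (Icc 0 T)
  hasDerivWithinAt : ∀ t ∈ Icc 0 T, HasDerivWithinAt (fun t => ι (v t)) (h t) (Icc 0 T) t
  weak_eq : ∀ (w : V) (η : ℝ → ℝ), ContDiff ℝ ∞ η → HasCompactSupport η →
    tsupport η ⊆ Ioo 0 T →
    -(∫ t in Ioo 0 T, inner ℝ (h t) (ι w) * deriv η t) + ∫ t in Ioo 0 T, inner ℝ (v t) w * η t =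
      ∫ t in Ioo 0 T, inner ℝ (G t) (ι w) * η t
  final : v T = 0
  deriv_final : h T = 0

theorem IsWeakWave.sub {ι : V →L[ℝ] H} {T : ℝ} {G : ℝ → H} {v₁ v₂ : ℝ → V} {h₁ h₂ : ℝ → H}
    (hv₁ : IsWeakWave ι T G v₁ h₁) (hv₂ : IsWeakWave ι T G v₂ h₂) :
    IsWeakWave ι T (fun _ => 0) (fun t => v₁ t - v₂ t) (fun t => h₁ t - h₂ t) where
  continuousOn := hv₁.continuousOn.sub hv₂.continuousOn
  continuousOn_deriv := hv₁.continuousOn_deriv.sub hv₂.continuousOn_deriv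
  hasDerivWithinAt t ht := by
    simp only [map_sub]
    exact (hv₁.hasDerivWithinAt t ht).sub (hv₂.hasDerivWithinAt t ht)
  weak_eq w η h1 h2 h3 := by
    have e1 := hv₁.weak_eq w η h1 h2 h3
    have e2 := hv₂.weak_eq w η h1 h2 h3
    have hd : Continuous (deriv η) := h1.continuous_deriv (by simp)
    have i1 {h : ℝ → H} (hh : ContinuousOn h (Icc 0 T)) :
        IntegrableOn (fun t => inner ℝ (h t) (ι w) * deriv η t) (Ioo 0 T) :=
      (((hh.inner continuousOn_const).mul hd.continuousOn).integrableOn_Icc).mono_set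
        Ioo_subset_Icc_self
    have i2 {v : ℝ → V} (hv : ContinuousOn v (Icc 0 T)) :
        IntegrableOn (fun t => inner ℝ (v t) w * η t) (Ioo 0 T) :=
      (((hv.inner continuousOn_const).mul h1.continuous.continuousOn).integrableOn_Icc).mono_set
        Ioo_subset_Icc_self
    simp only [inner_sub_left, sub_mul, inner_zero_left, zero_mul, integral_zero]
    rw [integral_sub (i1 hv₁.continuousOn_deriv) (i1 hv₂.continuousOn_deriv),
      integral_sub (i2 hv₁.continuousOn) (i2 hv₂.continuousOn)]
    linarith
  final := by rw [hv₁.final, hv₂.final, sub_zero]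
  deriv_final := by rw [hv₁.deriv_final, hv₂.deriv_final, sub_zero]

end WeakWave

/-! ### The abstract wave equation on V × H -/

section Abstract

variable {V H : Type*} [NormedAddCommGroup V] [InnerProductSpace ℝ V] [CompleteSpace V]
  [NormedAddCommGroup H] [InnerProductSpace ℝ H] [CompleteSpace H]

/-- For a dense embedding `ι : V → H` with associated operator `A`, the inverse
`(f, g) ↦ (-A⁻¹ g, f)` of the wave operator `(v, h) ↦ (h, -A v)` on `V × H`. -/
def waveInv (ι : V →L[ℝ] H) : WithLp 2 (V × H) →L[ℝ] WithLp 2 (V × H) :=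
  (WithLp.prodContinuousLinearEquiv 2 ℝ V H).symm.toContinuousLinearMap ∘L
    ((-(ContinuousLinearMap.adjoint ι) ∘L WithLp.sndL 2 ℝ V H).prod (ι ∘L WithLp.fstL 2 ℝ V H))

@[simp]
theorem waveInv_fst (ι : V →L[ℝ] H) (x : WithLp 2 (V × H)) :
    (waveInv ι x).fst = -ContinuousLinearMap.adjoint ι x.snd := rfl

@[simp]
theorem waveInv_snd (ι : V →L[ℝ] H) (x : WithLp 2 (V × H)) :
    (waveInv ι x).snd = ι x.fst := rfl

theorem waveInv_mem_skewAdjoint (ι : V →L[ℝ] H) :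
    waveInv ι ∈ skewAdjoint (WithLp 2 (V × H) →L[ℝ] WithLp 2 (V × H)) := by
  rw [skewAdjoint.mem_iff, ContinuousLinearMap.star_eq_adjoint, eq_comm,
    ContinuousLinearMap.eq_adjoint_iff]
  intro x y
  simp only [WithLp.prod_inner_apply, WithLp.ofLp_fst, WithLp.ofLp_snd, neg_apply,
    waveInv_fst, waveInv_snd, inner_neg_left, inner_neg_right,
    ContinuousLinearMap.adjoint_inner_left, ContinuousLinearMap.adjoint_inner_right]
  ring

theorem adjoint_injective_of_denseRange {ι : V →L[ℝ] H} (hd : DenseRange ι) :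
    Function.Injective (ContinuousLinearMap.adjoint ι) := by
  refine (injective_iff_map_eq_zero _).2 fun h hh => ?_
  have h0 : inner ℝ h h = 0 := hd.induction_on (p := fun y => inner ℝ h y = 0) h
    (isClosed_eq (continuous_const.inner continuous_id) continuous_const)
    fun w => by rw [← ContinuousLinearMap.adjoint_inner_left, hh, inner_zero_left]
  exact inner_self_eq_zero.1 h0

/-- One component needs ι injective, the other ι* injective, and the latter is the density of the
range of ι. -/
theorem waveInv_injective {ι : V →L[ℝ] H} (hi : Function.Injective ι) (hd : DenseRange ι) :
    Function.Injective (waveInv ι) := by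
  intro x y h
  have h1 : (waveInv ι x).fst = (waveInv ι y).fst := by rw [h]
  have h2 : (waveInv ι x).snd = (waveInv ι y).snd := by rw [h]
  rw [waveInv_fst, waveInv_fst, neg_inj] at h1
  rw [waveInv_snd, waveInv_snd] at h2
  exact WithLp.ofLp_injective 2 (Prod.ext (hi h2) (adjoint_injective_of_denseRange hd h1))

/-- Uniqueness of weak solutions, by conservation of `‖A⁻¹ᐟ² v'‖² + ‖v‖²`. -/
theorem IsWeakWave.eq_zero {ι : V →L[ℝ] H} (hi : Function.Injective ι) {T : ℝ} (hT : 0 < T)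
    {v : ℝ → V} {h : ℝ → H} (hv : IsWeakWave ι T (fun _ => 0) v h) :
    ∀ t ∈ Icc 0 T, v t = 0 := by
  -- A globally continuous extension of v has a primitive that is differentiable everywhere,
  -- including at the endpoints.
  obtain ⟨v', hv'c, hv'⟩ : ∃ v' : ℝ → V, Continuous v' ∧ EqOn v' v (Icc 0 T) :=
    ⟨IccExtend hT.le (domRestrict (Icc 0 T) v),
      (continuousOn_iff_continuous_domRestrict.1 hv.continuousOn).Icc_extend',
      fun t ht => IccExtend_of_mem _ _ ht⟩
  have hpd (t : ℝ) : HasDerivAt (fun t => ∫ s in (0)..t, v' s) (v' t) t :=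
    intervalIntegral.integral_hasDerivAt_right (hv'c.intervalIntegrable _ _)
      (hv'c.stronglyMeasurableAtFilter _ _) hv'c.continuousAt
  -- The weak equation says that ι*h has distributional derivative -v. Tested against w, the
  -- function ⟨h, ιw⟩ + ∫⟨v, w⟩ has zero distributional derivative and is constant.
  have key (t : ℝ) (ht : t ∈ Icc 0 T) : ContinuousLinearMap.adjoint ι (h t) =
      ContinuousLinearMap.adjoint ι (h 0) - ∫ s in (0)..t, v' s := by
    refine ext_inner_right ℝ fun w => ?_
    have hψ : Continuous fun t => inner ℝ (v' t) w := hv'c.inner continuous_const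
    have hψp : Continuous fun t => ∫ s in (0)..t, inner ℝ (v' s) w :=
      intervalIntegral.continuous_primitive (fun _ _ => hψ.intervalIntegrable _ _) 0
    have hh : ContinuousOn (fun t => inner ℝ (h t) (ι w)) (Icc 0 T) :=
      hv.continuousOn_deriv.inner continuousOn_const
    obtain ⟨c, hc⟩ := eqOn_const_of_integral_mul_deriv_eq_zero hT (hh.add hψp.continuousOn)
      fun η h1 h2 h3 => by
        have hw := hv.weak_eq w η h1 h2 h3
        have hd : Continuous (deriv η) := h1.continuous_deriv (by simp)
        have hw2 := integral_add_primitive_mul_deriv hT.le (hψ.intervalIntegrable 0 T) 0 h1 h3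
        have e1 : ∫ t in Ioo 0 T, inner ℝ (v' t) w * η t =
            ∫ t in Ioo 0 T, inner ℝ (v t) w * η t :=
          setIntegral_congr_fun measurableSet_Ioo fun t ht => by
            simp only [hv' (Ioo_subset_Icc_self ht)]
        simp only [inner_zero_left, zero_mul, integral_zero] at hw
        simp only [zero_add] at hw2
        simp only [Pi.add_apply, add_mul]
        rw [integral_add, hw2, e1]
        · linarith
        · exact ((hh.mul hd.continuousOn).integrableOn_Icc).mono_set Ioo_subset_Icc_self
        · exact ((hψp.mul hd).continuousOn.integrableOn_Icc).mono_set Ioo_subset_Icc_self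
    have h0 := hc (left_mem_Icc.2 hT.le)
    have h1 := hc ht
    simp only [Pi.add_apply, intervalIntegral.integral_same, add_zero] at h0 h1
    have h2 : inner ℝ (∫ s in (0)..t, v' s) w = ∫ s in (0)..t, inner ℝ (v' s) w := by
      simp_rw [real_inner_comm w]
      rw [intervalIntegral.integral_of_le ht.1, intervalIntegral.integral_of_le ht.1,
        integral_inner]
      exact hv'c.integrableOn_Ioc
    rw [inner_sub_left, h2, ContinuousLinearMap.adjoint_inner_left,
      ContinuousLinearMap.adjoint_inner_left]
    linarith
  -- The usual energy ‖v'‖² + ‖v‖² in H × V cannot be differentiated directly, as v' need not lie in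
  -- V. One level lower both terms are differentiable, and the derivative is -2⟨ι*h, v⟩ + 2⟨ιv, h⟩ =
  -- 0.
  have hconst := constant_of_has_deriv_right_zero (a := 0) (b := T)
    (f := fun t => ‖ContinuousLinearMap.adjoint ι (h t)‖ ^ 2 + ‖ι (v t)‖ ^ 2)
    ((((ContinuousLinearMap.adjoint ι).continuous.comp_continuousOn
      hv.continuousOn_deriv).norm.pow 2).add
      ((ι.continuous.comp_continuousOn hv.continuousOn).norm.pow 2)) fun t ht => by
    have ht' := Ico_subset_Icc_self ht
    have d1 : HasDerivWithinAt (fun t => ContinuousLinearMap.adjoint ι (h t)) (-v t)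
        (Icc 0 T) t := by
      have := ((hpd t).const_sub (ContinuousLinearMap.adjoint ι (h 0))).hasDerivWithinAt
        (s := Icc 0 T)
      rw [hv' ht'] at this
      exact this.congr key (key t ht')
    have d2 := (d1.norm_sq.add (hv.hasDerivWithinAt t ht').norm_sq)
    refine (d2.mono_of_mem_nhdsWithin (Icc_mem_nhdsGE_of_mem ht)).congr_deriv ?_
    rw [inner_neg_right, ContinuousLinearMap.adjoint_inner_left, real_inner_comm]
    ring
  intro t ht
  have h1 := hconst t ht
  have h2 := hconst T (right_mem_Icc.2 hT.le)
  simp only [hv.final, hv.deriv_final, map_zero, norm_zero] at h1 h2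
  have h3 : ‖ι (v t)‖ ^ 2 = 0 := by
    nlinarith [sq_nonneg ‖ContinuousLinearMap.adjoint ι (h t)‖, sq_nonneg ‖ι (v t)‖]
  have h4 : ι (v t) = 0 := by simpa using h3
  exact hi (by rw [h4, map_zero])

theorem IsWeakWave.eqOn {ι : V →L[ℝ] H} (hi : Function.Injective ι) {T : ℝ} (hT : 0 < T)
    {G : ℝ → H} {v₁ v₂ : ℝ → V} {h₁ h₂ : ℝ → H} (hv₁ : IsWeakWave ι T G v₁ h₁)
    (hv₂ : IsWeakWave ι T G v₂ h₂) : EqOn v₁ v₂ (Icc 0 T) ∧ EqOn h₁ h₂ (Icc 0 T) := by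
  have h1 : EqOn v₁ v₂ (Icc 0 T) := fun t ht =>
    sub_eq_zero.1 ((hv₁.sub hv₂).eq_zero hi hT t ht)
  refine ⟨h1, fun t ht => ?_⟩
  have h2 := hv₂.hasDerivWithinAt t ht
  exact (uniqueDiffOn_Icc hT t ht).eq_deriv _ (hv₁.hasDerivWithinAt t ht)
    (h2.congr (fun s hs => by rw [h1 hs]) (by rw [h1 ht]))

theorem hasDerivWithinAt_of_eq_add_primitive {X : Type*} [NormedAddCommGroup X] [NormedSpace ℝ X]
    [CompleteSpace X] {T : ℝ} {y c : ℝ → X} {x : X} (hc : Continuous c)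
    (hy : ∀ t, 0 ≤ t → y t = x + ∫ s in (0)..t, c s) {t : ℝ} (ht : t ∈ Icc 0 T) :
    HasDerivWithinAt y (c t) (Icc 0 T) t := by
  have h : HasDerivAt (fun t => x + ∫ s in (0)..t, c s) (c t) t :=
    (intervalIntegral.integral_hasDerivAt_right (hc.intervalIntegrable _ _)
      (hc.stronglyMeasurableAtFilter _ _) hc.continuousAt).const_add x
  exact h.hasDerivWithinAt.congr (fun s hs => hy s hs.1) (hy t ht.1)

theorem fst_intervalIntegral {f : ℝ → WithLp 2 (V × H)} (a b : ℝ)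
    (hf : IntervalIntegrable f volume a b) :
    (∫ t in a..b, f t).fst = ∫ t in a..b, (f t).fst :=
  ((WithLp.fstL 2 ℝ V H).intervalIntegral_comp_comm hf).symm

theorem snd_intervalIntegral {f : ℝ → WithLp 2 (V × H)} (a b : ℝ)
    (hf : IntervalIntegrable f volume a b) :
    (∫ t in a..b, f t).snd = ∫ t in a..b, (f t).snd :=
  ((WithLp.sndL 2 ℝ V H).intervalIntegral_comp_comm hf).symm

variable {ι : V →L[ℝ] H} {U : ℝ → WithLp 2 (V × H) →L[ℝ] WithLp 2 (V × H)}

theorem IsUnitaryFlow.intervalIntegrable_mildSol_add {E : Type*} [NormedAddCommGroup E]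
    [InnerProductSpace ℝ E] {J : E →L[ℝ] E} {U : ℝ → E →L[ℝ] E} (hU : IsUnitaryFlow J U)
    (y₀ : E) {f : ℝ → E} (hf : Integrable f) (a b : ℝ) :
    IntervalIntegrable (fun τ => mildSol U y₀ f τ + J (f τ)) volume a b :=
  ((hU.continuous_mildSol y₀ hf).intervalIntegrable _ _).add
    (J.integrable_comp hf).intervalIntegrable

/-- This and the next identity are the two components of the equation for JY. Without forcing in the
first component they say (ιv)' = h and (ι*h)' = ι*G - v, which is the wave equation. -/
theorem IsUnitaryFlow.apply_fst_mildSol (hU : IsUnitaryFlow (waveInv ι) U)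
    (y₀ : WithLp 2 (V × H)) {f : ℝ → WithLp 2 (V × H)} (hf : Integrable f) {t : ℝ}
    (ht : 0 ≤ t) :
    ι (mildSol U y₀ f t).fst =
      ι y₀.fst + ∫ τ in (0)..t, ((mildSol U y₀ f τ).snd + ι (f τ).fst) := by
  have h := congrArg WithLp.snd (hU.apply_mildSol (waveInv_mem_skewAdjoint ι) y₀ hf ht)
  rw [WithLp.add_snd, snd_intervalIntegral _ _ (hU.intervalIntegrable_mildSol_add y₀ hf 0 t)] at h
  exact h

theorem IsUnitaryFlow.adjoint_snd_mildSol (hU : IsUnitaryFlow (waveInv ι) U)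
    (y₀ : WithLp 2 (V × H)) {f : ℝ → WithLp 2 (V × H)} (hf : Integrable f) {t : ℝ}
    (ht : 0 ≤ t) :
    ContinuousLinearMap.adjoint ι (mildSol U y₀ f t).snd =
      ContinuousLinearMap.adjoint ι y₀.snd + ∫ τ in (0)..t,
        (ContinuousLinearMap.adjoint ι (f τ).snd - (mildSol U y₀ f τ).fst) := by
  have h := congrArg WithLp.fst (hU.apply_mildSol (waveInv_mem_skewAdjoint ι) y₀ hf ht)
  rw [WithLp.add_fst, fst_intervalIntegral _ _ (hU.intervalIntegrable_mildSol_add y₀ hf 0 t),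
    waveInv_fst, waveInv_fst, neg_eq_iff_eq_neg, neg_add, neg_neg,
    ← intervalIntegral.integral_neg] at h
  rw [h]
  congr 2; ext τ
  rw [WithLp.add_fst, waveInv_fst]
  abel

theorem isWeakWave_of_integral_eq {G : ℝ → H} (hG : Integrable G) {T : ℝ} (hT : 0 ≤ T)
    {v : ℝ → V} {h : ℝ → H} (hv : Continuous v) (hh : Continuous h) {x : H} {y : V}
    (hιv : ∀ t, 0 ≤ t → ι (v t) = x + ∫ s in (0)..t, h s)
    (hιh : ∀ t, 0 ≤ t → ContinuousLinearMap.adjoint ι (h t) =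
      y + ∫ s in (0)..t, (ContinuousLinearMap.adjoint ι (G s) - v s))
    (hvT : v T = 0) (hhT : h T = 0) : IsWeakWave ι T G v h := by
  refine ⟨hv.continuousOn, hh.continuousOn,
    fun t ht => hasDerivWithinAt_of_eq_add_primitive hh hιv ht, fun w η h1 h2 h3 => ?_, hvT, hhT⟩
  have hq : Integrable (fun t => inner ℝ (G t) (ι w)) := hG.inner_const _
  have hvw : Continuous fun t => inner ℝ (v t) w := hv.inner continuous_const
  have hqi : IntervalIntegrable (fun t => inner ℝ (G t) (ι w) - inner ℝ (v t) w) volume 0 T :=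
    hq.intervalIntegrable.sub (hvw.intervalIntegrable _ _)
  have e1 (t : ℝ) (ht : 0 ≤ t) : inner ℝ (h t) (ι w) = inner ℝ y w +
      ∫ s in (0)..t, (inner ℝ (G s) (ι w) - inner ℝ (v s) w) := by
    have k1 : Integrable (fun s => ContinuousLinearMap.adjoint ι (G s) - v s)
        (volume.restrict (Ioc 0 t)) :=
      ((ContinuousLinearMap.adjoint ι).integrable_comp hG).restrict.sub hv.integrableOn_Ioc
    rw [← ContinuousLinearMap.adjoint_inner_left, hιh t ht, inner_add_left,
      intervalIntegral.integral_of_le ht, intervalIntegral.integral_of_le ht, add_right_inj,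
      real_inner_comm, ← integral_inner k1]
    congr 1; ext s
    rw [real_inner_comm, inner_sub_left, ContinuousLinearMap.adjoint_inner_left]
  have e2 := integral_add_primitive_mul_deriv hT hqi (inner ℝ y w) h1 h3
  have e3 : ∫ t in Ioo 0 T, inner ℝ (h t) (ι w) * deriv η t =
      -∫ t in Ioo 0 T, (inner ℝ (G t) (ι w) - inner ℝ (v t) w) * η t := by
    rw [← e2]
    exact setIntegral_congr_fun measurableSet_Ioo fun t ht => by simp only [e1 t ht.1.le]
  have hη : Continuous η := h1.continuous
  have i1 : IntegrableOn (fun t => inner ℝ (v t) w * η t) (Ioo 0 T) :=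
    (hvw.mul hη).continuousOn.integrableOn_Icc.mono_set Ioo_subset_Icc_self
  have i2 : IntegrableOn (fun t => inner ℝ (G t) (ι w) * η t) (Ioo 0 T) := by
    obtain ⟨C, hC⟩ := h2.exists_bound_of_continuous hη
    exact (hq.mul_bdd hη.aestronglyMeasurable (Eventually.of_forall hC)).restrict
  simp only [sub_mul] at e3
  rw [integral_sub i2 i1] at e3
  linarith

theorem IsUnitaryFlow.exists_isWeakWave (hU : IsUnitaryFlow (waveInv ι) U) {G : ℝ → H}
    (hG : Integrable G) {T : ℝ} (hT : 0 ≤ T) :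
    ∃ z₀ : WithLp 2 (V × H),
      mildSol U z₀ (fun t => WithLp.toLp 2 (0, G t)) T = 0 ∧
      IsWeakWave ι T G (fun t => (mildSol U z₀ (fun t => WithLp.toLp 2 (0, G t)) t).fst)
        (fun t => (mildSol U z₀ (fun t => WithLp.toLp 2 (0, G t)) t).snd) := by
  have hg := integrable_toLp_inr (V := V) hG
  -- The initial value that cancels the Duhamel integral at time T.
  refine ⟨-∫ τ in (0)..T, U (-τ) (WithLp.toLp 2 (0, G τ)), by simp [mildSol], ?_⟩
  have hc := hU.continuous_mildSol (-∫ τ in (0)..T, U (-τ) (WithLp.toLp 2 (0, G τ))) hg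
  refine isWeakWave_of_integral_eq (x := ι (-∫ τ in (0)..T, U (-τ) (WithLp.toLp 2 (0, G τ))).fst)
    hG hT ((WithLp.continuous_fst 2 V H).comp hc)
    ((WithLp.continuous_snd 2 V H).comp hc) (fun t ht => ?_)
    (fun t ht => hU.adjoint_snd_mildSol _ hg ht) (by simp [mildSol]) (by simp [mildSol])
  simpa using hU.apply_fst_mildSol (-∫ τ in (0)..T, U (-τ) (WithLp.toLp 2 (0, G τ))) hg ht

/-- By uniqueness v is the mild backward solution, so the Green formula applies; its term at T
vanishes, and the forcings (φ, 0) and (0, G) each select one component. -/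
theorem IsUnitaryFlow.integral_inner_snd_mildSol (hU : IsUnitaryFlow (waveInv ι) U)
    (hi : Function.Injective ι) {φ : ℝ → V} (hφ : Integrable φ) (y₀ : WithLp 2 (V × H)) {T : ℝ}
    (hT : 0 < T) {G : ℝ → H} (hG : Integrable G) {v : ℝ → V} {h : ℝ → H}
    (hv : IsWeakWave ι T G v h) :
    ∫ t in Ioo 0 T, inner ℝ (mildSol U y₀ (fun t => WithLp.toLp 2 (φ t, 0)) t).snd (G t) =
      -(∫ t in Ioo 0 T, inner ℝ (φ t) (v t)) - inner ℝ y₀.fst (v 0) - inner ℝ y₀.snd (h 0) := by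
  have hf := integrable_toLp_inl (H := H) hφ
  have hg := integrable_toLp_inr (V := V) hG
  obtain ⟨z₀, hz, hz'⟩ := hU.exists_isWeakWave hG hT.le
  obtain ⟨hv1, hh1⟩ := hv.eqOn hi hT hz'
  have h0 : (0 : ℝ) ∈ Icc 0 T := left_mem_Icc.2 hT.le
  have k := hU.integral_inner_mildSol y₀ z₀ hf hg hT.le
  have k0 : mildSol U z₀ (fun t => WithLp.toLp 2 (0, G t)) 0 = z₀ := by
    simp [mildSol, hU.zero_apply]
  have k1 := hv1 h0
  have k2 := hh1 h0
  simp only [k0] at k1 k2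
  have k3 : ∫ t in Ioo 0 T, inner ℝ (φ t) (v t) = ∫ t in Ioo 0 T, inner ℝ (φ t)
      (mildSol U z₀ (fun t => WithLp.toLp 2 (0, G t)) t).fst :=
    setIntegral_congr_fun measurableSet_Ioo fun t ht => by
      simp only [hv1 (Ioo_subset_Icc_self ht)]
  rw [hz, inner_zero_right, intervalIntegral.integral_of_le hT.le,
    intervalIntegral.integral_of_le hT.le, integral_Ioc_eq_integral_Ioo,
    integral_Ioc_eq_integral_Ioo] at k
  simp only [WithLp.prod_inner_apply, WithLp.ofLp_fst, WithLp.ofLp_snd,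
    inner_zero_left, inner_zero_right, add_zero, zero_add, ← k1, ← k2] at k
  rw [k3]
  linarith

/-- Existence of a very weak solution `u` of `u'' + A u = F`, `u(0) = u₀`, `u'(0) = u₁`, where
`φ` and `r` represent `F` and `u₁`, and `-p` represents `u'`. -/
theorem exists_veryWeak (hi : Function.Injective ι) (hd : DenseRange ι) {φ : ℝ → V}
    (hφ : Integrable φ) (u₀ : H) (r : V) {T : ℝ} (hT : 0 < T) :
    ∃ (u : ℝ → H) (p : ℝ → V), Continuous u ∧ Continuous p ∧
      (∀ t, 0 ≤ t → ContinuousLinearMap.adjoint ι (u t) =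
        ContinuousLinearMap.adjoint ι u₀ + ∫ s in (0)..t, p s) ∧
      (∀ t, 0 ≤ t → ‖u t‖ ≤ ‖u₀‖ + ‖r‖ + ∫ t, ‖φ t‖) ∧
      (∀ t, 0 ≤ t → ‖p t‖ ≤ ‖u₀‖ + ‖r‖ + ∫ t, ‖φ t‖) ∧
      ∀ (G : ℝ → H) (v : ℝ → V) (h : ℝ → H), Integrable G → IsWeakWave ι T G v h →
        ∫ t in Ioo 0 T, inner ℝ (u t) (G t) =
          (∫ t in Ioo 0 T, inner ℝ (φ t) (v t)) + inner ℝ r (v 0) - inner ℝ u₀ (h 0) := by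
  obtain ⟨U, hU⟩ := exists_isUnitaryFlow (waveInv_mem_skewAdjoint ι) (waveInv_injective hi hd)
  have hφn : Integrable fun t => -φ t := hφ.neg
  have hf := integrable_toLp_inl (H := H) hφn
  -- The mild solution is Y = (-p, u): its second component satisfies (ι*u)' = p, hence the sign of
  -- r here and of φ in the forcing.
  obtain ⟨y₀, hy₀⟩ : ∃ y₀ : WithLp 2 (V × H), y₀ = WithLp.toLp 2 (-r, u₀) := ⟨_, rfl⟩
  have hc := hU.continuous_mildSol y₀ hf
  have hy₀n : ‖y₀‖ ≤ ‖u₀‖ + ‖r‖ := by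
    refine le_of_sq_le_sq ?_ (by positivity)
    rw [hy₀, WithLp.prod_norm_sq_eq_of_L2]
    simp only [WithLp.toLp_fst, WithLp.toLp_snd, norm_neg]
    nlinarith [norm_nonneg u₀, norm_nonneg r]
  have hn (t : ℝ) (ht : 0 ≤ t) := hU.norm_mildSol_le y₀ hf ht
  have ha (t : ℝ) (ht : 0 ≤ t) := hU.adjoint_snd_mildSol y₀ hf ht
  have hd (G : ℝ → H) (v : ℝ → V) (h : ℝ → H) (hG : Integrable G) (hv : IsWeakWave ι T G v h) :=
    hU.integral_inner_snd_mildSol hi hφn y₀ hT hG hv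
  simp only [WithLp.norm_toLp_fst, norm_neg] at hn
  generalize mildSol U y₀ (fun t => WithLp.toLp 2 (-φ t, 0)) = Y at *
  refine ⟨fun t => (Y t).snd, fun t => -(Y t).fst, (WithLp.continuous_snd 2 V H).comp hc,
    ((WithLp.continuous_fst 2 V H).comp hc).neg, fun t ht => ?_, fun t ht => ?_, fun t ht => ?_,
    fun G v h hG hv => ?_⟩
  · rw [ha t ht, hy₀]
    simp
  · have h1 := WithLp.norm_snd_le V (Y t)
    have h2 := hn t ht
    linarith
  · have h1 := WithLp.norm_fst_le V (Y t)
    have h2 := hn t ht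
    rw [norm_neg]
    linarith
  · rw [hd G v h hG hv, hy₀]
    have e1 : inner ℝ (WithLp.toLp 2 (-r, u₀) : WithLp 2 (V × H)).fst (v 0) = -inner ℝ r (v 0) :=
      inner_neg_left _ _
    rw [e1]
    simp only [inner_neg_left, integral_neg, neg_neg, sub_neg_eq_add, WithLp.toLp_snd]

end Abstract

/-! ### H̃^s(Ω) as a Hilbert space densely embedded in L̃²(Ω) -/

section Concrete

variable {n : ℕ}

/-- The Fourier transform of a test function is Schwartz, and the Sobolev weight is dominated by a
polynomial, so the product is square integrable. -/
theorem sobolevENorm_lt_top_of_mem_testFun {Ω : Set (EuclideanSpace ℝ (Fin n))} (s : ℝ≥0)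
    {u : L2R n} (hu : u ∈ testFun Ω) : sobolevENorm s u < ⊤ := by
  obtain ⟨φ, h1, h2, h3, h4⟩ := hu
  have g1 : ContDiff ℝ ∞ (fun x => (φ x : ℂ)) := Complex.ofRealCLM.contDiff.comp h1
  have g2 : HasCompactSupport (fun x => (φ x : ℂ)) := h2.comp_left (g := Complex.ofReal) rfl
  obtain ⟨f, hf⟩ : ∃ f : SchwartzMap (EuclideanSpace ℝ (Fin n)) ℂ, ∀ x, f x = φ x :=
    ⟨g2.toSchwartzMap g1, fun x => rfl⟩
  have e1 : Complex.ofRealCLM.compLpL 2 volume u = f.toLp 2 := by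
    apply Lp.ext
    filter_upwards [ContinuousLinearMap.coeFn_compLpL (p := 2) Complex.ofRealCLM u,
      f.coeFn_toLp 2, h4] with x k1 k2 k3
    rw [k1, k2, k3, hf]; rfl
  obtain ⟨g, hg⟩ : ∃ g : SchwartzMap (EuclideanSpace ℝ (Fin n)) ℂ, g = 𝓕 f := ⟨_, rfl⟩
  have e2 : fourierL2 u = g.toLp 2 := by
    change 𝓕 (Complex.ofRealCLM.compLpL 2 volume u) = _
    rw [e1, SchwartzMap.toLp_fourier_eq, hg]
  obtain ⟨k, hk⟩ := exists_nat_ge ((s : ℝ) / 2)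
  have hp : (fun ξ : EuclideanSpace ℝ (Fin n) =>
      (1 + (2 * Real.pi) ^ 2 * ‖ξ‖ ^ 2) ^ k).HasTemperateGrowth := by fun_prop
  have hm := (SchwartzMap.smulLeftCLM ℂ (fun ξ : EuclideanSpace ℝ (Fin n) =>
      (1 + (2 * Real.pi) ^ 2 * ‖ξ‖ ^ 2) ^ k) g).memLp 2 volume
  refine lt_of_le_of_lt ?_ hm.2
  unfold sobolevENorm
  refine eLpNorm_mono_ae ?_
  rw [e2]
  filter_upwards [g.coeFn_toLp 2 volume] with ξ hξ
  rw [hξ, SchwartzMap.smulLeftCLM_apply_apply hp, norm_smul, norm_smul]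
  refine mul_le_mul_of_nonneg_right ?_ (norm_nonneg _)
  have h0 : 1 ≤ 1 + (2 * Real.pi * ‖ξ‖) ^ 2 := by nlinarith [sq_nonneg (2 * Real.pi * ‖ξ‖)]
  rw [Real.norm_of_nonneg (by positivity), Real.norm_of_nonneg (by positivity), ← mul_pow]
  calc (1 + (2 * Real.pi * ‖ξ‖) ^ 2) ^ ((s : ℝ) / 2) ≤ (1 + (2 * Real.pi * ‖ξ‖) ^ 2) ^ (k : ℝ) :=
        Real.rpow_le_rpow_of_exponent_le h0 hk
    _ = _ := Real.rpow_natCast _ _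

theorem mem_HTildeSub_of_mem_testFun {Ω : Set (EuclideanSpace ℝ (Fin n))} (s : ℝ≥0)
    {u : LTilde Ω} (hu : (u : L2R n) ∈ testFun Ω) : u ∈ HTildeSub s Ω := by
  refine ⟨sobolevENorm_lt_top_of_mem_testFun s hu, fun ε hε => ⟨u, hu, ?_⟩⟩
  have h0 : sobolevENorm s (0 : L2R n) = 0 := by simpa using sobolevENorm_smul s 0 (0 : L2R n)
  rwa [sub_self, h0]

theorem denseRange_toLTilde (s : ℝ≥0) (Ω : Set (EuclideanSpace ℝ (Fin n))) :
    DenseRange (toLTilde : HTilde s Ω →ₗ[ℝ] LTilde Ω) := by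
  intro u
  rw [Metric.mem_closure_iff]
  intro ε hε
  obtain ⟨φ, hφ, h⟩ := Metric.mem_closure_iff.1 u.2 ε hε
  exact ⟨⟨φ, subset_closure hφ⟩, ⟨⟨⟨φ, subset_closure hφ⟩, mem_HTildeSub_of_mem_testFun s hφ⟩, rfl⟩,
    h⟩

theorem toLTilde_injective (s : ℝ≥0) (Ω : Set (EuclideanSpace ℝ (Fin n))) :
    Function.Injective (toLTilde : HTilde s Ω →ₗ[ℝ] LTilde Ω) :=
  Subtype.val_injective

theorem weight_le (s : ℝ≥0) {x : ℝ} (hx : 0 ≤ x) :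
    (1 + x ^ 2) ^ ((s : ℝ) / 2) ≤ 2 ^ ((s : ℝ) / 2) * (1 + x ^ (2 * ((s : ℝ) / 2))) := by
  have hs : 0 ≤ (s : ℝ) / 2 := by positivity
  have h0 : 0 ≤ x ^ (2 * ((s : ℝ) / 2)) := Real.rpow_nonneg hx _
  have h2 : (0 : ℝ) ≤ 2 ^ ((s : ℝ) / 2) := by positivity
  rcases le_total x 1 with h | h
  · calc (1 + x ^ 2) ^ ((s : ℝ) / 2) ≤ 2 ^ ((s : ℝ) / 2) :=
          Real.rpow_le_rpow (by positivity) (by nlinarith) hs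
      _ ≤ _ := le_mul_of_one_le_right h2 (by linarith)
  · calc (1 + x ^ 2) ^ ((s : ℝ) / 2) ≤ (2 * x ^ (2 : ℝ)) ^ ((s : ℝ) / 2) :=
          Real.rpow_le_rpow (by positivity) (by rw [Real.rpow_two]; nlinarith) hs
      _ = 2 ^ ((s : ℝ) / 2) * x ^ (2 * ((s : ℝ) / 2)) := by
        rw [Real.mul_rpow (by norm_num) (by positivity), ← Real.rpow_mul hx]
      _ ≤ _ := mul_le_mul_of_nonneg_left (by linarith) h2

/-- The inhomogeneous weight is at most a constant times 1 + (2π|ξ|)^s, so the L² norm together with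
the homogeneous norm controls the full H^s norm. -/
theorem sobolevENorm_le (s : ℝ≥0) (u : L2R n) (g : L2C n)
    (hg : g =ᵐ[volume] fun ξ : EuclideanSpace ℝ (Fin n) =>
      ((2 * Real.pi * ‖ξ‖) ^ (2 * ((s : ℝ) / 2)) : ℝ) • fourierL2 u ξ) :
    sobolevENorm s u ≤ ENNReal.ofReal (2 ^ ((s : ℝ) / 2)) * (‖u‖ₑ + ‖g‖ₑ) := by
  have e1 : ‖u‖ₑ = eLpNorm (fourierL2 u) 2 volume := by
    rw [← Lp.enorm_def, ← ofReal_norm, ← ofReal_norm, norm_fourierL2]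
  have e2 : eLpNorm (fun ξ => ‖fourierL2 u ξ‖ + ‖g ξ‖) 2 volume ≤ ‖u‖ₑ + ‖g‖ₑ := by
    rw [e1, Lp.enorm_def, ← eLpNorm_norm (fourierL2 u), ← eLpNorm_norm g]
    exact eLpNorm_add_le (Lp.aestronglyMeasurable _).norm (Lp.aestronglyMeasurable _).norm
      (by norm_num)
  refine le_trans ?_ (mul_le_mul_right e2 _)
  unfold sobolevENorm
  refine eLpNorm_le_mul_eLpNorm_of_ae_le_mul ?_ 2
  filter_upwards [hg] with ξ hξ
  have h0 : 0 ≤ 2 * Real.pi * ‖ξ‖ := by positivity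
  rw [hξ, norm_smul, norm_smul, Real.norm_of_nonneg (by positivity),
    Real.norm_of_nonneg (by positivity), Real.norm_of_nonneg (by positivity)]
  have := mul_le_mul_of_nonneg_right (weight_le s h0) (norm_nonneg (fourierL2 u ξ))
  linarith

theorem tendsto_fourierL2 {u : ℕ → L2R n} {w : L2R n} (h : Tendsto u atTop (𝓝 w)) :
    Tendsto (fun k => fourierL2 (u k)) atTop (𝓝 (fourierL2 w)) := by
  rw [tendsto_iff_norm_sub_tendsto_zero] at h ⊢
  simpa only [← map_sub, norm_fourierL2] using h

/-- Multiplication by the symbol is a closed operator: after passing to a subsequence for each of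
the two L² limits, the relation holds in the limit almost everywhere. -/
theorem ae_eq_symbol_smul_of_tendsto (s : ℝ≥0) {u : ℕ → L2R n} {w : L2R n} {g : ℕ → L2C n}
    {G : L2C n} (hu : Tendsto u atTop (𝓝 w)) (hg : Tendsto g atTop (𝓝 G))
    (h : ∀ k, g k =ᵐ[volume] fun ξ : EuclideanSpace ℝ (Fin n) =>
      ((2 * Real.pi * ‖ξ‖) ^ (2 * ((s : ℝ) / 2)) : ℝ) • fourierL2 (u k) ξ) :
    G =ᵐ[volume] fun ξ : EuclideanSpace ℝ (Fin n) =>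
      ((2 * Real.pi * ‖ξ‖) ^ (2 * ((s : ℝ) / 2)) : ℝ) • fourierL2 w ξ := by
  obtain ⟨a, ha, h1⟩ := (tendstoInMeasure_of_tendsto_Lp (tendsto_fourierL2 hu)).exists_seq_tendsto_ae
  obtain ⟨b, hb, h2⟩ :=
    (tendstoInMeasure_of_tendsto_Lp (hg.comp ha.tendsto_atTop)).exists_seq_tendsto_ae
  filter_upwards [h1, h2, ae_all_iff.2 h] with ξ k1 k2 k3
  refine tendsto_nhds_unique k2 ?_
  simp only [Function.comp_apply, k3]
  exact (k1.comp hb.tendsto_atTop).const_smul _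

variable [NeZero n] {s : ℝ≥0} {Ω : Set (EuclideanSpace ℝ (Fin n))}

theorem norm_halfLap (u : HTilde s Ω) : ‖halfLap u‖ = ‖u‖ := rfl

/-- The inclusion `H̃^s(Ω) ⊆ L̃²(Ω)`, as a continuous linear map. -/
def toLTildeL (s : ℝ≥0) (hΩ : Bornology.IsBounded Ω) : HTilde s Ω →L[ℝ] LTilde Ω :=
  LinearMap.mkContinuousOfExistsBound (toLTilde : HTilde s Ω →ₗ[ℝ] LTilde Ω) (by
    obtain ⟨C, hC⟩ := poincare (s := s) hΩ
    exact ⟨C, fun u => hC u⟩)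

@[simp]
theorem toLTildeL_apply (hΩ : Bornology.IsBounded Ω) (u : HTilde s Ω) :
    toLTildeL s hΩ u = toLTilde u := rfl

/-- By the Poincaré inequality a Cauchy sequence converges in L² together with its half Laplacians,
and closedness of the multiplier identifies the limits. -/
theorem completeSpace_HTilde (hΩ : Bornology.IsBounded Ω) : CompleteSpace (HTilde s Ω) := by
  refine Metric.complete_of_cauchySeq_tendsto fun u hu => ?_
  have h1 : CauchySeq fun k => toLTilde (u k) := hu.map (toLTildeL s hΩ).uniformContinuous
  have h2 : CauchySeq fun k => halfLap (u k) :=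
    hu.map ((halfLap : HTilde s Ω →ₗ[ℝ] L2C n).mkContinuousOfExistsBound
      ⟨1, fun x => by rw [one_mul, norm_halfLap]⟩).uniformContinuous
  obtain ⟨w, hw⟩ := cauchySeq_tendsto_of_complete h1
  obtain ⟨G, hG⟩ := cauchySeq_tendsto_of_complete h2
  have hw' : Tendsto (fun k => (toLTilde (u k) : L2R n)) atTop (𝓝 w) :=
    (continuous_subtype_val.tendsto w).comp hw
  let 𝓣 := Lp.fourierTransformₗᵢ (EuclideanSpace ℝ (Fin n)) ℂ
  have hG' : Tendsto (fun k => 𝓣 (halfLap (u k))) atTop (𝓝 (𝓣 G)) :=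
    (𝓣.continuous.tendsto G).comp hG
  have hk (k : ℕ) := fourier_fracLap s (toLTilde (u k) : L2R n) (u k).2.1
  have hwG := ae_eq_symbol_smul_of_tendsto s hw' hG' hk
  have hfin : sobolevENorm s (w : L2R n) < ⊤ :=
    (sobolevENorm_le s _ _ hwG).trans_lt
      (ENNReal.mul_lt_top (by simp) (ENNReal.add_lt_top.2 ⟨by simp, by simp⟩))
  -- Membership in H̃^s(Ω) asks for approximation by test functions in the full H^s norm, while the
  -- Cauchy property is in the homogeneous norm; this bound passes from one to the other.
  have hdiff (k : ℕ) : sobolevENorm s ((w : L2R n) - (toLTilde (u k) : L2R n)) ≤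
      ENNReal.ofReal (2 ^ ((s : ℝ) / 2)) *
        (‖(w : L2R n) - (toLTilde (u k) : L2R n)‖ₑ + ‖𝓣 G - 𝓣 (halfLap (u k))‖ₑ) := by
    refine sobolevENorm_le s _ _ ?_
    rw [map_sub]
    filter_upwards [hwG, hk k, Lp.coeFn_sub (𝓣 G) (𝓣 (halfLap (u k))),
      Lp.coeFn_sub (fourierL2 (w : L2R n)) (fourierL2 (toLTilde (u k) : L2R n))] with ξ k1 k2 k3 k4
    rw [k3, k4, Pi.sub_apply, Pi.sub_apply, k1, smul_sub]
    exact congrArg _ k2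
  have hlim : Tendsto (fun k => ENNReal.ofReal (2 ^ ((s : ℝ) / 2)) *
      (‖(w : L2R n) - (toLTilde (u k) : L2R n)‖ₑ + ‖𝓣 G - 𝓣 (halfLap (u k))‖ₑ)) atTop (𝓝 0) := by
    have t1 := (tendsto_const_nhds (x := (w : L2R n))).sub hw'
    have t2 := (tendsto_const_nhds (x := 𝓣 G)).sub hG'
    have t3 := ENNReal.Tendsto.const_mul (a := ENNReal.ofReal (2 ^ ((s : ℝ) / 2)))
      (t1.enorm.add t2.enorm) (Or.inr (by simp))
    simpa using t3
  have hmem : w ∈ HTildeSub s Ω := by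
    refine ⟨hfin, fun ε hε => ?_⟩
    obtain ⟨k, hk⟩ := (hlim.eventually_lt_const (ENNReal.half_pos hε.ne')).exists
    obtain ⟨φ, hφ, h3⟩ := (u k).2.2 (ε / 2) (ENNReal.half_pos hε.ne')
    refine ⟨φ, hφ, ?_⟩
    have e : (w : L2R n) - φ = ((w : L2R n) - (toLTilde (u k) : L2R n)) + ((toLTilde (u k) : L2R n) - φ) := by
      abel
    rw [e]
    refine (sobolevENorm_add_le s _ _).trans_lt ?_
    calc _ < ε / 2 + ε / 2 := ENNReal.add_lt_add ((hdiff k).trans_lt hk) h3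
      _ = ε := ENNReal.add_halves ε
  obtain ⟨W, hW⟩ : ∃ W : HTilde s Ω, toLTilde W = w := ⟨⟨w, hmem⟩, rfl⟩
  have hWG : halfLap W = G := by
    apply 𝓣.injective
    apply Lp.ext
    refine EventuallyEq.trans ?_ hwG.symm
    rw [← hW]
    exact fourier_fracLap s (toLTilde W : L2R n) W.2.1
  refine ⟨W, tendsto_iff_norm_sub_tendsto_zero.2 ?_⟩
  have := tendsto_iff_norm_sub_tendsto_zero.1 hG
  rw [← hWG] at this
  simpa only [← map_sub, norm_halfLap] using this

instance : InnerProductSpace ℝ (HTilde s Ω) where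
  inner := innerHTilde
  norm_sq_eq_re_inner u := by
    change ‖halfLap u‖ ^ 2 = (inner ℂ (halfLap u) (halfLap u)).re
    rw [inner_self_eq_norm_sq_to_K]
    norm_cast
  conj_inner_symm u v := by
    change (inner ℂ (halfLap v) (halfLap u)).re = (inner ℂ (halfLap u) (halfLap v)).re
    rw [← inner_conj_symm, Complex.conj_re]
  add_left u v w := by
    change (inner ℂ (halfLap (u + v)) (halfLap w)).re = _
    rw [map_add, inner_add_left, Complex.add_re]
    rfl
  smul_left u v c := by
    change (inner ℂ (halfLap (c • u)) (halfLap v)).re = _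
    rw [map_smul]
    have : c • halfLap u = (c : ℂ) • halfLap u := rfl
    rw [this, inner_smul_left, Complex.conj_ofReal, Complex.re_ofReal_mul]
    rfl

theorem toHNeg_apply (hΩ : Bornology.IsBounded Ω) (u : LTilde Ω) (w : HTilde s Ω) :
    toHNeg s hΩ u w = inner ℝ u (toLTilde w) := rfl

end Concrete

/-! ### Transfer to the fractional wave equation -/

theorem integral_norm_Lp_two_le {X : Type*} [NormedAddCommGroup X] {T : ℝ} (hT : 0 ≤ T)
    (F : Lp X 2 (volume.restrict (Ioo 0 T))) : ∫ t in Ioo 0 T, ‖F t‖ ≤ √T * ‖F‖ := by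
  have h1 : eLpNorm F 1 (volume.restrict (Ioo 0 T)) ≤ ‖F‖ₑ * ENNReal.ofReal T ^ (1 / 2 : ℝ) := by
    have := eLpNorm_le_eLpNorm_mul_rpow_measure_univ (p := 1) (q := 2) (by norm_num)
      (Lp.aestronglyMeasurable F)
    rw [Measure.restrict_apply_univ, Real.volume_Ioo, sub_zero, ← Lp.enorm_def] at this
    convert this using 2
    norm_num
  rw [integral_norm_eq_lintegral_enorm (Lp.aestronglyMeasurable F),
    ← eLpNorm_one_eq_lintegral_enorm]
  refine ENNReal.toReal_le_of_le_ofReal (by positivity) (h1.trans (le_of_eq ?_))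
  rw [ENNReal.ofReal_mul (by positivity), mul_comm, ofReal_norm, Real.sqrt_eq_rpow,
    ENNReal.ofReal_rpow_of_nonneg hT (by norm_num)]

theorem integrable_Lp_two {X : Type*} [NormedAddCommGroup X] {T : ℝ}
    (F : Lp X 2 (volume.restrict (Ioo 0 T))) : IntegrableOn F (Ioo 0 T) :=
  (Lp.memLp F).integrable (by norm_num)

/-- The Riesz map of a real Hilbert space, as a linear map. -/
def rieszL (V : Type*) [NormedAddCommGroup V] [InnerProductSpace ℝ V] [CompleteSpace V] :
    V →L[ℝ] StrongDual ℝ V :=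
  LinearMap.mkContinuous
    { toFun := InnerProductSpace.toDual ℝ V
      map_add' := map_add _
      map_smul' := fun c x => by simp } 1 fun x => by simp

theorem rieszL_apply {V : Type*} [NormedAddCommGroup V] [InnerProductSpace ℝ V] [CompleteSpace V]
    (x y : V) : rieszL V x y = inner ℝ x y := rfl

theorem norm_rieszL {V : Type*} [NormedAddCommGroup V] [InnerProductSpace ℝ V] [CompleteSpace V]
    (x : V) : ‖rieszL V x‖ = ‖x‖ :=
  (InnerProductSpace.toDual ℝ V).norm_map x

theorem contDiffOn_one_of_hasDerivWithinAt {X : Type*} [NormedAddCommGroup X] [NormedSpace ℝ X]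
    {T : ℝ} (hT : 0 < T) {f f' : ℝ → X} (hf : ∀ t ∈ Icc 0 T, HasDerivWithinAt f (f' t) (Icc 0 T) t)
    (hc : ContinuousOn f' (Icc 0 T)) : ContDiffOn ℝ 1 f (Icc 0 T) := by
  have hu := uniqueDiffOn_Icc hT
  rw [show (1 : WithTop ℕ∞) = 0 + 1 by rfl, contDiffOn_succ_iff_derivWithin hu]
  refine ⟨fun t ht => (hf t ht).differentiableWithinAt, by simp, ?_⟩
  rw [contDiffOn_zero]
  exact hc.congr fun t ht => (hf t ht).derivWithin (hu t ht)

section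

variable {n : ℕ} [NeZero n] {s : ℝ≥0} {Ω : Set (EuclideanSpace ℝ (Fin n))}

/-- The datum G is only meaningful on (0, T), whereas the flow acts on functions integrable on ℝ;
extension by zero reconciles the two. -/
theorem IsBackwardWeakSol.isWeakWave (hΩ : Bornology.IsBounded Ω) {T : ℝ} (hT : 0 < T)
    {G : Lp (LTilde Ω) 2 (volume.restrict (Ioo 0 T))} {v : ℝ → HTilde s Ω}
    (hv : IsBackwardWeakSol T G v) :
    IsWeakWave (toLTildeL s hΩ) T ((Ioo 0 T).indicator G) v (dtLTilde T v) where
  continuousOn := hv.continuousOn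
  continuousOn_deriv := hv.contDiffOn.continuousOn_derivWithin (uniqueDiffOn_Icc hT) le_rfl
  hasDerivWithinAt t ht :=
    ((hv.contDiffOn.differentiableOn (by norm_num)) t ht).hasDerivWithinAt
  weak_eq w η h1 h2 h3 := by
    refine (hv.weak_eq w η h1 h2 h3).trans ?_
    refine setIntegral_congr_fun measurableSet_Ioo fun t ht => ?_
    simp only [indicator_of_mem ht, toLTildeL_apply]
  final := hv.final
  deriv_final := hv.dt_final

theorem IsWeakWave.isBackwardWeakSol (hΩ : Bornology.IsBounded Ω) {T : ℝ} (hT : 0 < T)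
    {G : Lp (LTilde Ω) 2 (volume.restrict (Ioo 0 T))} {v : ℝ → HTilde s Ω} {h : ℝ → LTilde Ω}
    (hv : IsWeakWave (toLTildeL s hΩ) T ((Ioo 0 T).indicator G) v h) :
    IsBackwardWeakSol T G v := by
  have hd : ∀ t ∈ Icc 0 T, dtLTilde T v t = h t := fun t ht =>
    (hv.hasDerivWithinAt t ht).derivWithin (uniqueDiffOn_Icc hT t ht)
  refine ⟨hv.continuousOn, contDiffOn_one_of_hasDerivWithinAt hT hv.hasDerivWithinAt
    hv.continuousOn_deriv, fun w η h1 h2 h3 => ?_, hv.final, ?_⟩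
  · have e1 : ∫ t in Ioo 0 T, inner ℝ (dtLTilde T v t) (toLTilde w) * deriv η t =
        ∫ t in Ioo 0 T, inner ℝ (h t) (toLTilde w) * deriv η t :=
      setIntegral_congr_fun measurableSet_Ioo fun t ht => by
        simp only [hd t (Ioo_subset_Icc_self ht)]
    rw [e1]
    refine (hv.weak_eq w η h1 h2 h3).trans ?_
    refine setIntegral_congr_fun measurableSet_Ioo fun t ht => ?_
    simp only [indicator_of_mem ht, toLTildeL_apply]
  · rw [hd T (right_mem_Icc.2 hT.le), hv.deriv_final]

theorem denseRange_toLTildeL (hΩ : Bornology.IsBounded Ω) : DenseRange (toLTildeL s hΩ) :=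
  denseRange_toLTilde s Ω

theorem toLTildeL_injective (hΩ : Bornology.IsBounded Ω) :
    Function.Injective (toLTildeL s hΩ) :=
  toLTilde_injective s Ω

theorem exists_isBackwardWeakSol (s : ℝ≥0) (hΩ : Bornology.IsBounded Ω) {T : ℝ} (hT : 0 < T)
    (G : Lp (LTilde Ω) 2 (volume.restrict (Ioo 0 T))) :
    ∃ v : ℝ → HTilde s Ω, IsBackwardWeakSol T G v := by
  have := completeSpace_HTilde (s := s) hΩ
  obtain ⟨U, hU⟩ := exists_isUnitaryFlow (waveInv_mem_skewAdjoint (toLTildeL s hΩ))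
    (waveInv_injective (toLTildeL_injective hΩ) (denseRange_toLTildeL hΩ))
  obtain ⟨z₀, -, hz⟩ := hU.exists_isWeakWave
    ((integrable_Lp_two G).integrable_indicator measurableSet_Ioo) hT.le
  exact ⟨_, hz.isBackwardWeakSol hΩ hT⟩

/-- With G = u - u' and a backward solution for it, the right-hand sides agree, so ∫‖u - u'‖² = 0;
continuity gives equality on the closed interval. -/
theorem IsVeryWeakSol.eqOn {hΩ : Bornology.IsBounded Ω} {T : ℝ} (hT : 0 < T)
    {F : Lp (HNeg s Ω) 2 (volume.restrict (Ioo 0 T))} {u₀ : LTilde Ω} {u₁ : HNeg s Ω}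
    {u u' : ℝ → LTilde Ω} (hu : IsVeryWeakSol hΩ T F u₀ u₁ u)
    (hu' : IsVeryWeakSol hΩ T F u₀ u₁ u') : EqOn u u' (Icc 0 T) := by
  have hc : ContinuousOn (fun t => u t - u' t) (Icc 0 T) := hu.continuousOn.sub hu'.continuousOn
  obtain ⟨C, hC⟩ := isCompact_Icc.exists_bound_of_continuousOn hc
  have hm : MemLp (fun t => u t - u' t) 2 (volume.restrict (Ioo 0 T)) := by
    refine MemLp.of_bound ((hc.mono Ioo_subset_Icc_self).aestronglyMeasurable measurableSet_Ioo) C ?_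
    filter_upwards [ae_restrict_mem measurableSet_Ioo] with t ht
    exact hC t (Ioo_subset_Icc_self ht)
  obtain ⟨v, hv⟩ := exists_isBackwardWeakSol s hΩ hT (hm.toLp _)
  have e := (hu.eq _ v hv).trans (hu'.eq _ v hv).symm
  have h1 {w : ℝ → LTilde Ω} : ∫ t in Ioo 0 T, inner ℝ (w t) (hm.toLp _ t) =
      ∫ t in Ioo 0 T, inner ℝ (w t) (u t - u' t) := by
    refine integral_congr_ae ?_
    filter_upwards [hm.coeFn_toLp] with t ht
    rw [ht]
  have h2 {w : ℝ → LTilde Ω} (hw : ContinuousOn w (Icc 0 T)) :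
      IntegrableOn (fun t => inner ℝ (w t) (u t - u' t)) (Ioo 0 T) :=
    (hw.inner hc).integrableOn_Icc.mono_set Ioo_subset_Icc_self
  rw [h1, h1, ← sub_eq_zero, ← integral_sub (h2 hu.continuousOn) (h2 hu'.continuousOn)] at e
  simp only [← inner_sub_left] at e
  rw [integral_eq_zero_iff_of_nonneg (fun t => real_inner_self_nonneg) (h2 hc)] at e
  have h3 : u =ᵐ[volume.restrict (Ioo 0 T)] u' := by
    filter_upwards [e] with t ht
    exact sub_eq_zero.1 (inner_self_eq_zero.1 ht)
  have h4 := Measure.eqOn_open_of_ae_eq h3 isOpen_Ioo (hu.continuousOn.mono Ioo_subset_Icc_self)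
    (hu'.continuousOn.mono Ioo_subset_Icc_self)
  exact h4.of_subset_closure hu.continuousOn hu'.continuousOn Ioo_subset_Icc_self
    (by rw [closure_Ioo hT.ne])

theorem exists_isVeryWeakSol (hΩ : Bornology.IsBounded Ω) {T : ℝ} (hT : 0 < T)
    (F : Lp (HNeg s Ω) 2 (volume.restrict (Ioo 0 T))) (u₀ : LTilde Ω) (u₁ : HNeg s Ω) :
    ∃ u : ℝ → LTilde Ω, IsVeryWeakSol hΩ T F u₀ u₁ u ∧
      ∀ t ∈ Icc 0 T,
        ‖u t‖ + ‖dtHNeg s hΩ T u t‖ ≤ 2 * (‖u₀‖ + ‖u₁‖ + √T * ‖F‖) := by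
  have := completeSpace_HTilde (s := s) hΩ
  let D := InnerProductSpace.toDual ℝ (HTilde s Ω)
  obtain ⟨φ, hφd⟩ : ∃ φ : ℝ → HTilde s Ω, φ = (Ioo 0 T).indicator fun t => D.symm (F t) :=
    ⟨_, rfl⟩
  have hDF : IntegrableOn (fun t => D.symm (F t)) (Ioo 0 T) :=
    (integrable_Lp_two F).norm.mono' (D.symm.continuous.comp_aestronglyMeasurable
      (integrable_Lp_two F).aestronglyMeasurable)
      (Eventually.of_forall fun t => (D.symm.norm_map _).le)
  have hφ : Integrable φ := by
    rw [hφd]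
    exact hDF.integrable_indicator measurableSet_Ioo
  have hφn : ∫ t, ‖φ t‖ ≤ √T * ‖F‖ := by
    refine le_trans (le_of_eq ?_) (integral_norm_Lp_two_le hT.le F)
    rw [← integral_indicator measurableSet_Ioo, hφd]
    congr 1; ext t
    rw [norm_indicator_eq_indicator_norm]
    by_cases ht : t ∈ Ioo 0 T
    · rw [indicator_of_mem ht, indicator_of_mem ht, D.symm.norm_map]
    · rw [indicator_of_notMem ht, indicator_of_notMem ht]
  obtain ⟨u, p, huc, hpc, hup, hun, hpn, heq⟩ := exists_veryWeak (toLTildeL_injective hΩ)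
    (denseRange_toLTildeL hΩ) hφ u₀ (D.symm u₁) hT
  rw [D.symm.norm_map] at hun hpn
  -- Under the Riesz isometry the embedding of L̃²(Ω) into H^{-s}(Ω) is ι*. Thus (ι*u)' = p says
  -- that p represents ∂ₜu.
  have hneg (w : LTilde Ω) : toHNeg s hΩ w =
      rieszL (HTilde s Ω) (ContinuousLinearMap.adjoint (toLTildeL s hΩ) w) := by
    ext x
    rw [rieszL_apply, ContinuousLinearMap.adjoint_inner_left, toHNeg_apply, toLTildeL_apply]
  have hder : ∀ t ∈ Icc 0 T, HasDerivWithinAt (fun τ => toHNeg s hΩ (u τ))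
      (rieszL (HTilde s Ω) (p t)) (Icc 0 T) t := fun t ht => by
    simp only [hneg]
    exact (rieszL (HTilde s Ω)).hasFDerivAt.comp_hasDerivWithinAt t
      (hasDerivWithinAt_of_eq_add_primitive hpc hup ht)
  refine ⟨u, ⟨huc.continuousOn, contDiffOn_one_of_hasDerivWithinAt hT hder
    ((rieszL (HTilde s Ω)).continuous.comp hpc).continuousOn, fun G v hv => ?_⟩, fun t ht => ?_⟩
  · have h := heq _ v _ ((integrable_Lp_two G).integrable_indicator measurableSet_Ioo)
      (hv.isWeakWave hΩ hT)
    have e1 : ∫ t in Ioo 0 T, inner ℝ (u t) ((Ioo 0 T).indicator G t) =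
        ∫ t in Ioo 0 T, inner ℝ (u t) (G t) :=
      setIntegral_congr_fun measurableSet_Ioo fun t ht => by
        simp only [indicator_of_mem ht]
    have e2 : ∫ t in Ioo 0 T, inner ℝ (φ t) (v t) = ∫ t in Ioo 0 T, (F t) (v t) :=
      setIntegral_congr_fun measurableSet_Ioo fun t ht => by
        simp only [hφd, indicator_of_mem ht]
        exact InnerProductSpace.toDual_symm_apply
    rw [← e1, h, e2]
    congr 2
    exact InnerProductSpace.toDual_symm_apply
  · have h1 : dtHNeg s hΩ T u t = rieszL (HTilde s Ω) (p t) :=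
      (hder t ht).derivWithin (uniqueDiffOn_Icc hT t ht)
    rw [h1, norm_rieszL]
    -- Each of ‖u t‖ and ‖p t‖ has the same bound, whence the factor 2.
    linarith [hun t ht.1, hpn t ht.1]

end

end NonlocalWave

end

theorem mainTheorem4 (n : ℕ) [NeZero n] (Ω : Set (EuclideanSpace ℝ (Fin n))) (hΩo : IsOpen Ω)
    (hΩ : Bornology.IsBounded Ω) (s : ℝ≥0) (hs : 0 < s) (T : ℝ) (hT : 0 < T) :
    ∃ C : ℝ, 0 < C ∧
      ∀ (F : Lp (NonlocalWave.HNeg s Ω) 2 (volume.restrict (Ioo 0 T)))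
        (u₀ : NonlocalWave.LTilde Ω) (u₁ : NonlocalWave.HNeg s Ω),
        ∃ u : ℝ → NonlocalWave.LTilde Ω,
          NonlocalWave.IsVeryWeakSol hΩ T F u₀ u₁ u ∧
          (∀ u' : ℝ → NonlocalWave.LTilde Ω,
            NonlocalWave.IsVeryWeakSol hΩ T F u₀ u₁ u' → EqOn u' u (Icc 0 T)) ∧
          ∀ t ∈ Icc 0 T,
            ‖u t‖ + ‖NonlocalWave.dtHNeg s hΩ T u t‖ ≤ C * (‖u₀‖ + ‖u₁‖ + ‖F‖) := by
  refine ⟨2 * (1 + √T), by positivity, fun F u₀ u₁ => ?_⟩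
  obtain ⟨u, hu, hb⟩ := NonlocalWave.exists_isVeryWeakSol hΩ hT F u₀ u₁
  refine ⟨u, hu, fun u' hu' => hu'.eqOn hT hu, fun t ht => (hb t ht).trans ?_⟩
  have h1 := mul_nonneg (Real.sqrt_nonneg T) (add_nonneg (norm_nonneg u₀) (norm_nonneg u₁))
  nlinarith [norm_nonneg F]
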